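/- Let $n\ge 2$ and let $\mathcal H$ be the $(n+1)$-dimensional irreducible unitary representation of $\mathfrak{su}(2)$, with orthonormal weight basis $|k\rangle$ ($k\in\{-n,-n+2,\dots,n\}$) and $\mathfrak{sl}(2)$-action $$E|k\rangle=\sqrt{\tfrac{(n-k)(n+k+2)}{4}}\,|k+2\rangle,\quad F|k\rangle=\sqrt{\tfrac{(n-k+2)(n+k)}{4}}\,|k-2\rangle,\quad H|k\rangle=k|k\rangle .$$ Let $\mathcal E=\operatorname{span}_{\mathbb C}\{I,E,F,H\}$, let $\mathcal E_t=\mathcal E^t$ ($t=0,1,2,\dots$) be the $\mathfrak{su}(2)$ quantum metric, and let $\mathcal V_t$ be the space of those elements of $\mathcal E_t$ that are orthogonal, for the Hilbert–Schmidt inner product $\operatorname{tr}(X^*Y)$, to $\mathcal E_s$ for all $s<t$. With $\mathcal B_t$ any orthonormal basis of $\mathcal V_t$, put $\Phi_t(X)=\sum_{B\in\mathcal B_t}BXB^*$ and $\Pi_t(X)=\sum_{B\in\mathcal B_t}\operatorname{tr}(B^*X)B$ for $0\le t\le n$, and let $W_t(j)\in\mathbb R$ be the coefficients with $\Phi_t=\sum_{j=0}^nW_t(j)\Pi_j$.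 A quantum code is a subspace $\mathcal C\subseteq\mathcal H$; let $P$ be the orthogonal projection onto it. The code has distance $2$ if for every $X\in\mathcal E_1$ there is $\varepsilon(X)\in\mathbb C$ with $PXP=\varepsilon(X)P$ (so its minimum distance is at least $2$). The distance distribution of a code $\mathcal C\ne 0$ is $A_t=\frac{n+1}{\dim\mathcal C}\sum_{B\in\mathcal B_t}|\operatorname{tr}(B^*P)|^2$ for $0\le t\le n$. A feasible distance distribution with value $K$ (for distance $2$) is a vector $(A_0,\dots,A_n)\in\mathbb R^{n+1}$ with $A_t\ge0$ for all $t$, $A_0=K$, $K\sum_{j}W_t(j)A_j=A_t$ for $t=0,1$, and $K\sum_jW_t(j)A_j\ge A_t$ for all $0\le t\le n$. Then: 1. Every quantum code $\mathcal C$ of distance $2$ satisfies $\dim\mathcal C\le\frac n2$. 2. The vector with $A_0=\frac n2$, $A_n=\frac n2+1$ and $A_t=0$ for $1\le t\le n-1$ is a feasible distance distribution with value $K=\frac n2$. 3. If $n\ge3$, it is the only feasible distance distribution with value $\frac n2$; and if moreover $\mathcal C$ is a quantum code of distance $2$ with $\dim\mathcal C=\frac n2$, then its distance distribution is this one. -/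

import Mathlib

open scoped Matrix

namespace SpinCode

/-- The `(n+1)`-dimensional Hilbert space of the irreducible representation of `𝔰𝔲(2)`. Its standard
orthonormal basis vector with index `i` is the weight vector of weight `k = 2 * i - n`. -/
abbrev Space (n : ℕ) : Type := EuclideanSpace ℂ (Fin (n + 1))

/-- The operators on `Space n`, as matrices with respect to its standard orthonormal basis. -/
abbrev Op (n : ℕ) : Type := Matrix (Fin (n + 1)) (Fin (n + 1)) ℂ

/-- The action of the raising operator of `𝔰𝔩(2)`: with `k = 2 * i - n`, it sends `|k⟩` to
`√((n - k) * (n + k + 2) / 4) |k + 2⟩`, where `(n - k) * (n + k + 2) / 4 = (n - i) * (i + 1)`. -/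
noncomputable def raising (n : ℕ) : Op n :=
  Matrix.of fun i' i =>
    if (i' : ℕ) = (i : ℕ) + 1 then ((Real.sqrt (((n : ℝ) - (i : ℕ)) * ((i : ℕ) + 1)) : ℝ) : ℂ) else 0

/-- The action of the lowering operator of `𝔰𝔩(2)`: with `k = 2 * i - n`, it sends `|k⟩` to
`√((n - k + 2) * (n + k) / 4) |k - 2⟩`, where `(n - k + 2) * (n + k) / 4 = (n - i + 1) * i`. -/
noncomputable def lowering (n : ℕ) : Op n :=
  Matrix.of fun i' i =>
    if (i' : ℕ) + 1 = (i : ℕ) then ((Real.sqrt (((n : ℝ) - (i : ℕ) + 1) * (i : ℕ)) : ℝ) : ℂ) else 0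

/-- The action of the weight operator of `𝔰𝔩(2)`: it sends `|k⟩` to `k |k⟩`, where `k = 2 * i - n`. -/
noncomputable def weight (n : ℕ) : Op n :=
  Matrix.diagonal fun i => (2 * (i : ℕ) - n : ℂ)

/-- The space `ℰ = span {I, E, F, H}` of generating errors. Since `E, F, H` span the
complexification `𝔰𝔩(2)` of `𝔰𝔲(2)`, this is the complex span of `I` and of the image of `𝔰𝔲(2)`. -/
noncomputable def generators (n : ℕ) : Submodule ℂ (Op n) :=
  Submodule.span ℂ {1, raising n, lowering n, weight n}

/-- The `𝔰𝔲(2)` quantum metric: the errors of distance at most `t` are `ℰ ^ t`, the linear span of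
the products of `t` elements of `ℰ`; for `t = 0` this is `ℂ I`. -/
noncomputable def errors (n t : ℕ) : Submodule ℂ (Op n) :=
  generators n ^ t

/-- The errors of distance exactly `t`: the elements of `ℰ ^ t` that are Hilbert-Schmidt orthogonal
to all errors of smaller distance. -/
noncomputable def exactErrors (n t : ℕ) : Submodule ℂ (Op n) where
  carrier := {X | X ∈ errors n t ∧ ∀ s < t, ∀ Y ∈ errors n s, (Yᴴ * X).trace = 0}
  zero_mem' := ⟨Submodule.zero_mem _, fun s _ Y _ => by simp⟩
  add_mem' := fun {X X'} hX hX' => ⟨Submodule.add_mem _ hX.1 hX'.1, fun s hs Y hY => by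
    simp [Matrix.mul_add, hX.2 s hs Y hY, hX'.2 s hs Y hY]⟩
  smul_mem' := fun c X hX => ⟨Submodule.smul_mem _ c hX.1, fun s hs Y hY => by
    simp [hX.2 s hs Y hY]⟩

/-- The family `b` is an orthonormal basis of `S` for the Hilbert-Schmidt inner product
`⟨X, Y⟩ = tr (Xᴴ Y)`. -/
def IsHSBasis {n : ℕ} {ι : Type} [DecidableEq ι] (S : Submodule ℂ (Op n)) (b : ι → Op n) : Prop :=
  (∀ i j, ((b i)ᴴ * b j).trace = if i = j then 1 else 0) ∧ Submodule.span ℂ (Set.range b) = S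

theorem exists_isHSBasis {n : ℕ} (S : Submodule ℂ (Op n)) :
    ∃ b : Fin (Module.finrank ℂ S) → Op n, IsHSBasis S b := by
  let e : EuclideanSpace ℂ (Fin (n + 1) × Fin (n + 1)) ≃ₗ[ℂ] Op n :=
    (WithLp.linearEquiv 2 ℂ (Fin (n + 1) × Fin (n + 1) → ℂ)).trans
      (LinearEquiv.curry ℂ ℂ (Fin (n + 1)) (Fin (n + 1)))
  have he : ∀ x y, ((e x)ᴴ * e y).trace = inner ℂ x y := by
    intro x y
    simp only [Matrix.trace, Matrix.diag, Matrix.mul_apply, Matrix.conjTranspose_apply,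
      PiLp.inner_apply, Fintype.sum_prod_type]
    rw [Finset.sum_comm]
    refine Finset.sum_congr rfl fun i _ => Finset.sum_congr rfl fun j _ => ?_
    rw [mul_comm]; rfl
  let T := S.comap e.toLinearMap
  have hr : Module.finrank ℂ T = Module.finrank ℂ S :=
    (LinearEquiv.finrank_eq (e.submoduleMap T)).trans
      (by rw [show T.map e.toLinearMap = S from
        Submodule.map_comap_eq_of_surjective e.surjective S])
  let v := (stdOrthonormalBasis ℂ T).reindex (finCongr hr)
  refine ⟨fun i => e (v i), fun i j => ?_, ?_⟩
  · rw [he, ← Submodule.coe_inner, orthonormal_iff_ite.mp v.orthonormal]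
  · have h : Set.range (fun i => e (v i)) = e.toLinearMap '' (T.subtype '' Set.range v) := by
      ext; simp
    rw [h, Submodule.span_image, Submodule.span_image, ← v.coe_toBasis, v.toBasis.span_eq,
      Submodule.map_top, Submodule.range_subtype]
    exact Submodule.map_comap_eq_of_surjective e.surjective S

/-- A Hilbert-Schmidt orthonormal basis of the space of errors of distance exactly `t`. -/
noncomputable def errorBasis (n t : ℕ) : Fin (Module.finrank ℂ (exactErrors n t)) → Op n :=
  (exists_isHSBasis (exactErrors n t)).choose

theorem errorBasis_spec (n t : ℕ) : IsHSBasis (exactErrors n t) (errorBasis n t) :=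
  (exists_isHSBasis (exactErrors n t)).choose_spec

/-- The superoperator `Φ_t(X) = ∑_{E ∈ 𝓑_t} E X Eᴴ`, which does not depend on the orthonormal
basis `𝓑_t`. -/
noncomputable def superPhi (n t : ℕ) (X : Op n) : Op n :=
  ∑ i, errorBasis n t i * X * (errorBasis n t i)ᴴ

/-- The superoperator `Π_t(X) = ∑_{E ∈ 𝓑_t} tr (Eᴴ X) E`, the orthogonal projection onto the space
of errors of distance exactly `t`. -/
noncomputable def superPi (n t : ℕ) (X : Op n) : Op n :=
  ∑ i, ((errorBasis n t i)ᴴ * X).trace • errorBasis n t i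

/-- The real scalars `W t j = W_t(j)` are the coefficients of the expansions
`Φ_t = ∑_j W_t(j) Π_j`. -/
def IsWCoeff (n : ℕ) (W : Fin (n + 1) → Fin (n + 1) → ℝ) : Prop :=
  ∀ (t : Fin (n + 1)) (X : Op n), superPhi n t X = ∑ j : Fin (n + 1), (W t j : ℂ) • superPi n j X

/-- The orthogonal projection onto a quantum code (a subspace of `Space n`). -/
noncomputable def codeProj {n : ℕ} (C : Submodule ℂ (Space n)) : Op n :=
  Matrix.toEuclideanLin.symm (C.starProjection : Space n →ₗ[ℂ] Space n)

/-- The code `C` with orthogonal projection `P` detects the error `X` if `P X P` is a scalar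
multiple of `P`. -/
def Detects {n : ℕ} (C : Submodule ℂ (Space n)) (X : Op n) : Prop :=
  ∃ ε : ℂ, codeProj C * X * codeProj C = ε • codeProj C

/-- `C` is a code of distance `d` (that is, its minimum distance is at least `d`): it detects all
errors of distance at most `d - 1`. -/
def HasDistance {n : ℕ} (C : Submodule ℂ (Space n)) (d : ℕ) : Prop :=
  ∀ s < d, ∀ X ∈ errors n s, Detects C X

/-- The distance distribution `A_t = (dim ℋ / dim C) ∑_{E ∈ 𝓑_t} |tr (Eᴴ P)|²` of a code. -/
noncomputable def distanceDistribution {n : ℕ} (C : Submodule ℂ (Space n)) (t : Fin (n + 1)) : ℝ :=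
  ((n : ℝ) + 1) / (Module.finrank ℂ C : ℝ) *
    ∑ i, ‖((errorBasis n t i)ᴴ * codeProj C).trace‖ ^ 2

/-- `A` is a feasible distance distribution with value `K` for the distance `d`: a solution of the
system of linear constraints satisfied by the distance distribution of any code of dimension `K` and
distance `d`. -/
def IsFeasible (n d : ℕ) (K : ℝ) (A : Fin (n + 1) → ℝ) : Prop :=
  ∃ W : Fin (n + 1) → Fin (n + 1) → ℝ, IsWCoeff n W ∧
    (∀ t, 0 ≤ A t) ∧
    A 0 = K ∧
    (∀ t : Fin (n + 1), (t : ℕ) < d → K * ∑ j, W t j * A j = A t) ∧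
    (∀ t, A t ≤ K * ∑ j, W t j * A j)

/-- The sequence with `A_0 = n / 2`, `A_n = n / 2 + 1` and `A_t = 0` for `1 ≤ t ≤ n - 1`. -/
noncomputable def extremalDistribution (n : ℕ) (t : Fin (n + 1)) : ℝ :=
  if (t : ℕ) = 0 then (n : ℝ) / 2 else if (t : ℕ) = n then (n : ℝ) / 2 + 1 else 0

end SpinCode

/-! Under the adjoint action of `𝔰𝔩(2)` the operators split orthogonally into irreducibles `V_0, …,
V_n`, where `V_t` has dimension `2t + 1` and highest weight vector `E^t`. These are exactly the
spaces of errors of distance exactly `t` (`span_tensor_eq_exactErrors`). Each `Φ_t` commutes with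
the action, so by Schur's lemma it is a scalar on every `V_j` (`superPhi_tensor`). This scalar is
`W_t(j)`, and evaluating one matrix entry of `Φ_t(E^j)` gives it explicitly in the four families
needed: `t = 0`, `t = 1`, `j = 0` and `j = n`.

The bound is linear programming (`linear_programming_bound`). The equality at `t = 0` says `∑ A_j =
n + 1`. The equality at `t = 1` expresses `A_1` through the second moment `M = ∑ j (j + 1) A_j`,
because `W_1(j)` is affine in `j (j + 1)`. The slack `S = ∑_{j ≥ 2} (n (n + 1) - j (j + 1)) A_j` is
nonnegative, and eliminating `M` gives `K S = K n (n + 1) (n/2 - K) + (n + 2) A_1 (n (n + 1)/6 - K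
(n - 1))`. If `K > n/2`, the first term is negative and the second is at most zero, a contradiction.
If `K = n/2` and `n ≥ 3`, the second coefficient is negative, so `A_1 = 0` and then `S = 0`, which
leaves only `A_0` and `A_n`. Only the two equalities are used here; a code of distance `2` satisfies
them by `HasDistance.constraint`.

The inequalities for `t ≥ 2` matter only for the feasibility of the extremal vector. They follow
from the columns `W_t(0)` and `W_t(n)`, the latter having sign `(-1)^t` and a factor that decreases
with `t`. -/

namespace SpinCode

variable {n : ℕ}

/-! ### Hilbert–Schmidt product and matrix entries -/

/-- The Hilbert-Schmidt inner product. -/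
noncomputable def hs (X Y : Op n) : ℂ := (Xᴴ * Y).trace

theorem hs_add_right (X Y Z : Op n) : hs X (Y + Z) = hs X Y + hs X Z := by
  simp [hs, Matrix.mul_add]

theorem hs_add_left (X Y Z : Op n) : hs (X + Y) Z = hs X Z + hs Y Z := by
  simp [hs, Matrix.add_mul]

theorem hs_sub_right (X Y Z : Op n) : hs X (Y - Z) = hs X Y - hs X Z := by
  simp [hs, Matrix.mul_sub]

theorem hs_smul_right (c : ℂ) (X Y : Op n) : hs X (c • Y) = c * hs X Y := by
  simp [hs]

theorem hs_smul_left (c : ℂ) (X Y : Op n) : hs (c • X) Y = star c * hs X Y := by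
  simp [hs]

@[simp] theorem hs_zero_right (X : Op n) : hs X 0 = 0 := by simp [hs]

@[simp] theorem hs_zero_left (X : Op n) : hs 0 X = 0 := by simp [hs]

theorem hs_sum_right {ι : Type*} (s : Finset ι) (X : Op n) (f : ι → Op n) :
    hs X (∑ i ∈ s, f i) = ∑ i ∈ s, hs X (f i) := by
  simp [hs, Matrix.mul_sum, Matrix.trace_sum]

theorem star_hs (X Y : Op n) : star (hs X Y) = hs Y X := by
  rw [hs, hs, ← Matrix.trace_conjTranspose, Matrix.conjTranspose_mul,
    Matrix.conjTranspose_conjTranspose]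

theorem hs_self_eq_zero {X : Op n} : hs X X = 0 ↔ X = 0 := by
  open scoped ComplexOrder in
  exact Matrix.trace_conjTranspose_mul_self_eq_zero_iff

theorem hs_eq_zero_comm {X Y : Op n} : hs X Y = 0 ↔ hs Y X = 0 := by
  rw [← star_hs, star_eq_zero]

/-- The matrix entries, extended by zero to all natural indices. -/
def entry (X : Op n) (i j : ℕ) : ℂ :=
  if h : i < n + 1 ∧ j < n + 1 then X ⟨i, h.1⟩ ⟨j, h.2⟩ else 0

theorem entry_coe (X : Op n) (i j : Fin (n + 1)) : entry X i j = X i j := by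
  rw [entry, dif_pos ⟨i.2, j.2⟩]

theorem entry_of_lt_left (X : Op n) {i : ℕ} (j : ℕ) (h : n < i) : entry X i j = 0 := by
  rw [entry, dif_neg (by omega)]

theorem entry_of_lt_right (X : Op n) (i : ℕ) {j : ℕ} (h : n < j) : entry X i j = 0 := by
  rw [entry, dif_neg (by omega)]

theorem ext_entry {X Y : Op n} (h : ∀ i j, entry X i j = entry Y i j) : X = Y := by
  ext i j
  simpa [entry_coe] using h i j

@[simp] theorem entry_zero (i j : ℕ) : entry (0 : Op n) i j = 0 := by simp [entry]

theorem entry_add (X Y : Op n) (i j : ℕ) : entry (X + Y) i j = entry X i j + entry Y i j := by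
  unfold entry; split_ifs <;> simp

theorem entry_sub (X Y : Op n) (i j : ℕ) : entry (X - Y) i j = entry X i j - entry Y i j := by
  unfold entry; split_ifs <;> simp

theorem entry_smul (c : ℂ) (X : Op n) (i j : ℕ) : entry (c • X) i j = c * entry X i j := by
  unfold entry; split_ifs <;> simp

theorem entry_conjTranspose (X : Op n) (i j : ℕ) : entry Xᴴ i j = star (entry X j i) := by
  unfold entry
  simp only [and_comm (a := i < n + 1)]
  split_ifs <;> simp

theorem entry_one (i j : ℕ) (hi : i ≤ n) : entry (1 : Op n) i j = if i = j then 1 else 0 := by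
  unfold entry
  split_ifs with h1 h2 h2
  · subst h2; simp
  · exact Matrix.one_apply_ne (by simpa using h2)
  · omega
  · rfl

theorem entry_mul (X Y : Op n) (i j : ℕ) :
    entry (X * Y) i j = ∑ k ∈ Finset.range (n + 1), entry X i k * entry Y k j := by
  by_cases h : i < n + 1 ∧ j < n + 1
  · rw [entry, dif_pos h, Matrix.mul_apply, Finset.sum_range]
    refine Finset.sum_congr rfl fun k _ => ?_
    rw [entry, dif_pos ⟨h.1, k.2⟩, entry, dif_pos ⟨k.2, h.2⟩]
  · rw [entry, dif_neg h, Finset.sum_eq_zero]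
    intro k _
    rcases not_and_or.mp h with h | h
    · rw [entry_of_lt_left X k (by omega), zero_mul]
    · rw [entry_of_lt_right Y k (by omega), mul_zero]

theorem hs_eq_sum (X Y : Op n) : hs X Y =
    ∑ j ∈ Finset.range (n + 1), ∑ i ∈ Finset.range (n + 1), star (entry X i j) * entry Y i j := by
  rw [hs, Matrix.trace, Finset.sum_range]
  refine Finset.sum_congr rfl fun j _ => ?_
  rw [Matrix.diag_apply, Matrix.mul_apply, Finset.sum_range]
  simp [entry_coe]

/-! ### The `𝔰𝔩(2)` generators and their commutators -/

/-- The matrix coefficient `√((n - i) (i + 1))` of the raising operator. -/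
noncomputable def raisingCoeff (n i : ℕ) : ℂ :=
  ((Real.sqrt (((n : ℝ) - i) * (i + 1)) : ℝ) : ℂ)

theorem raisingCoeff_self (n : ℕ) : raisingCoeff n n = 0 := by simp [raisingCoeff]

theorem star_raisingCoeff (n i : ℕ) : star (raisingCoeff n i) = raisingCoeff n i :=
  Complex.conj_ofReal _

theorem raisingCoeff_mul_self {i : ℕ} (h : i ≤ n) :
    raisingCoeff n i * raisingCoeff n i = ((n : ℂ) - i) * (i + 1) := by
  have h' : (i : ℝ) ≤ n := by exact_mod_cast h
  rw [raisingCoeff, ← Complex.ofReal_mul, Real.mul_self_sqrt]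
  · push_cast; ring
  · exact mul_nonneg (by linarith) (by positivity)

theorem raisingCoeff_ne_zero {i : ℕ} (h : i < n) : raisingCoeff n i ≠ 0 := by
  intro h0
  have h1 := raisingCoeff_mul_self h.le
  rw [h0, zero_mul, eq_comm, mul_eq_zero, sub_eq_zero] at h1
  rcases h1 with h1 | h1
  · exact h.ne' (by exact_mod_cast h1)
  · exact Nat.cast_add_one_ne_zero i h1

theorem raisingCoeff_reflect {i j : ℕ} (h : i + j + 1 = n) :
    raisingCoeff n i = raisingCoeff n j := by
  have h' : (n : ℝ) = i + j + 1 := by exact_mod_cast h.symm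
  rw [raisingCoeff, raisingCoeff, h']
  congr 2
  ring

theorem entry_raising (i j : ℕ) :
    entry (raising n) i j = if i = j + 1 ∧ i ≤ n then raisingCoeff n j else 0 := by
  unfold entry raising raisingCoeff
  simp only [Matrix.of_apply]
  by_cases h : i = j + 1 ∧ i ≤ n
  · rw [dif_pos (by omega), if_pos h.1, if_pos h]
  · rw [if_neg h]
    split_ifs
    · omega
    · rfl
    · rfl

theorem lowering_eq : lowering n = (raising n)ᴴ := by
  ext i j
  simp only [lowering, raising, Matrix.conjTranspose_apply, Matrix.of_apply]
  by_cases h : (i : ℕ) + 1 = j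
  · rw [if_pos h, if_pos h.symm]
    have h' : (j : ℝ) = i + 1 := by exact_mod_cast h.symm
    rw [Complex.star_def, Complex.conj_ofReal, h']
    congr 2
    ring
  · rw [if_neg h, if_neg (fun h' => h h'.symm), star_zero]

theorem entry_raising_mul_succ (X : Op n) (i j : ℕ) :
    entry (raising n * X) (i + 1) j = raisingCoeff n i * entry X i j := by
  rw [entry_mul]
  simp only [entry_raising]
  by_cases h : i < n
  · rw [Finset.sum_eq_single i]
    · rw [if_pos (by omega)]
    · intro k _ hk
      rw [if_neg (by omega), zero_mul]
    · intro h'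
      simp at h'; omega
  · rw [Finset.sum_eq_zero]
    · rcases (not_lt.mp h).lt_or_eq with h | h
      · rw [entry_of_lt_left X j h, mul_zero]
      · rw [← h, raisingCoeff_self, zero_mul]
    · intro k _
      rw [if_neg (by omega), zero_mul]

theorem entry_raising_mul_zero (X : Op n) (j : ℕ) : entry (raising n * X) 0 j = 0 := by
  rw [entry_mul, Finset.sum_eq_zero]
  intro k _
  rw [entry_raising, if_neg (by omega), zero_mul]

theorem entry_mul_raising (X : Op n) (i j : ℕ) :
    entry (X * raising n) i j = entry X i (j + 1) * raisingCoeff n j := by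
  rw [entry_mul]
  simp only [entry_raising]
  by_cases h : j < n
  · rw [Finset.sum_eq_single (j + 1)]
    · rw [if_pos (by omega)]
    · intro k _ hk
      rw [if_neg (by omega), mul_zero]
    · intro h'
      simp at h'; omega
  · rw [Finset.sum_eq_zero]
    · rw [entry_of_lt_right X i (by omega), zero_mul]
    · intro k _
      rw [if_neg (by omega), mul_zero]

theorem entry_lowering_mul (X : Op n) (i j : ℕ) :
    entry (lowering n * X) i j = raisingCoeff n i * entry X (i + 1) j := by
  have h : lowering n * X = (Xᴴ * raising n)ᴴ := by
    rw [Matrix.conjTranspose_mul, Matrix.conjTranspose_conjTranspose, lowering_eq]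
  rw [h, entry_conjTranspose, entry_mul_raising, star_mul', star_raisingCoeff,
    entry_conjTranspose, star_star, mul_comm]

theorem entry_mul_lowering_succ (X : Op n) (i j : ℕ) :
    entry (X * lowering n) i (j + 1) = entry X i j * raisingCoeff n j := by
  have h : X * lowering n = (raising n * Xᴴ)ᴴ := by
    rw [Matrix.conjTranspose_mul, Matrix.conjTranspose_conjTranspose, lowering_eq]
  rw [h, entry_conjTranspose, entry_raising_mul_succ, star_mul', star_raisingCoeff,
    entry_conjTranspose, star_star, mul_comm]

theorem entry_mul_lowering_zero (X : Op n) (i : ℕ) : entry (X * lowering n) i 0 = 0 := by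
  have h : X * lowering n = (raising n * Xᴴ)ᴴ := by
    rw [Matrix.conjTranspose_mul, Matrix.conjTranspose_conjTranspose, lowering_eq]
  rw [h, entry_conjTranspose, entry_raising_mul_zero, star_zero]

theorem entry_weight_mul (X : Op n) (i j : ℕ) :
    entry (weight n * X) i j = (2 * i - n) * entry X i j := by
  unfold entry weight
  split_ifs <;> simp [Matrix.diagonal_mul]

theorem entry_mul_weight (X : Op n) (i j : ℕ) :
    entry (X * weight n) i j = entry X i j * (2 * j - n) := by
  unfold entry weight
  split_ifs <;> simp [Matrix.mul_diagonal]

/-- The adjoint action of `H` grades operators by diagonals, so weight arguments become statements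
about the support of matrices. -/
theorem entry_lie_weight (X : Op n) (i j : ℕ) :
    entry ⁅weight n, X⁆ i j = 2 * (i - j) * entry X i j := by
  rw [Ring.lie_def, entry_sub, entry_weight_mul, entry_mul_weight]
  ring

theorem lie_raising_lowering : ⁅raising n, lowering n⁆ = weight n := by
  refine ext_entry fun i j => ?_
  rw [Ring.lie_def, entry_sub, entry_lowering_mul, entry_raising]
  have hw : entry (weight n) i j = if i = j ∧ i ≤ n then (2 * i - n : ℂ) else 0 := by
    rw [← mul_one (weight n), entry_weight_mul]
    by_cases hi : i ≤ n
    · rw [entry_one i j hi]; simp [hi]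
    · rw [entry_of_lt_left _ _ (by omega), if_neg (by omega), mul_zero]
  rw [hw]
  have hl : entry (lowering n) (i - 1) j
      = if i - 1 + 1 = j ∧ j ≤ n then raisingCoeff n (i - 1) else 0 := by
    rw [lowering_eq, entry_conjTranspose, entry_raising, apply_ite star, star_raisingCoeff,
      star_zero]
    simp only [eq_comm]
  rcases i with _ | i
  · rw [entry_raising_mul_zero]
    by_cases h : 0 = j
    · subst h
      by_cases hn : 1 ≤ n
      · rw [if_pos ⟨rfl, hn⟩, raisingCoeff_mul_self (Nat.zero_le _)]; simp
      · obtain rfl : n = 0 := by omega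
        simp
    · rw [if_neg (by omega), if_neg (by omega)]; simp
  · rw [entry_raising_mul_succ]
    simp only [Nat.add_sub_cancel] at hl
    rw [hl]
    by_cases h : i + 1 = j
    · subst h
      rcases lt_trichotomy n (i + 1) with h | h | h
      · rw [if_neg (by omega), if_neg (by omega), if_neg (by omega)]; simp
      · rw [if_pos (by omega), if_neg (by omega), if_pos (by omega),
          raisingCoeff_mul_self (by omega), h]
        push_cast; ring
      · rw [if_pos (by omega), if_pos (by omega), if_pos (by omega),
          raisingCoeff_mul_self (by omega), raisingCoeff_mul_self (by omega)]
        push_cast; ring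
    · rw [if_neg (by omega), if_neg (by omega), if_neg (by omega)]; simp

theorem lie_weight_raising : ⁅weight n, raising n⁆ = (2 : ℂ) • raising n := by
  refine ext_entry fun i j => ?_
  rw [entry_lie_weight, entry_smul, entry_raising]
  split_ifs with h
  · rw [h.1]; push_cast; ring
  · simp

/-! ### Invariance of the metric under the adjoint action -/

/-- Since `F = Eᴴ`, cyclicity of the trace makes `ad E` and `ad F` mutually adjoint. -/
theorem hs_lie_raising (X Y : Op n) : hs X ⁅raising n, Y⁆ = hs ⁅lowering n, X⁆ Y := by
  rw [hs, hs, Ring.lie_def, Ring.lie_def, Matrix.conjTranspose_sub, Matrix.conjTranspose_mul,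
    Matrix.conjTranspose_mul, lowering_eq, Matrix.conjTranspose_conjTranspose, Matrix.mul_sub,
    Matrix.sub_mul, Matrix.trace_sub, Matrix.trace_sub, Matrix.mul_assoc]
  congr 1
  rw [← Matrix.mul_assoc, Matrix.trace_mul_comm, ← Matrix.mul_assoc]

theorem hs_lie_lowering (X Y : Op n) : hs X ⁅lowering n, Y⁆ = hs ⁅raising n, X⁆ Y := by
  rw [← star_hs, ← hs_lie_raising, star_hs]

theorem comm_add (A X Y : Op n) : ⁅A, X + Y⁆ = ⁅A, X⁆ + ⁅A, Y⁆ := by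
  simp only [Ring.lie_def]; noncomm_ring

theorem comm_smul (c : ℂ) (A X : Op n) : ⁅A, c • X⁆ = c • ⁅A, X⁆ := by
  simp only [Ring.lie_def, Matrix.mul_smul, Matrix.smul_mul, smul_sub]

@[simp] theorem comm_zero (A : Op n) : ⁅A, (0 : Op n)⁆ = 0 := by
  simp [Ring.lie_def]

@[simp] theorem comm_self (A : Op n) : ⁅A, A⁆ = 0 := by
  simp [Ring.lie_def]

theorem comm_skew (A X : Op n) : -⁅X, A⁆ = ⁅A, X⁆ := by
  simp only [Ring.lie_def]; noncomm_ring

theorem comm_comm (A B X : Op n) : ⁅A, ⁅B, X⁆⁆ = ⁅⁅A, B⁆, X⁆ + ⁅B, ⁅A, X⁆⁆ := by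
  simp only [Ring.lie_def]; noncomm_ring

theorem raising_mem_generators : raising n ∈ generators n :=
  Submodule.subset_span (by simp)

theorem lowering_mem_generators : lowering n ∈ generators n :=
  Submodule.subset_span (by simp)

theorem lie_weight_lowering : ⁅weight n, lowering n⁆ = (-2 : ℂ) • lowering n := by
  refine ext_entry fun i j => ?_
  rw [entry_lie_weight, entry_smul, lowering_eq, entry_conjTranspose, entry_raising]
  split_ifs with h
  · rw [h.1]; push_cast; ring
  · simp

theorem lie_mem_generators {A X : Op n} (hA : A = raising n ∨ A = lowering n)
    (hX : X ∈ generators n) : ⁅A, X⁆ ∈ generators n := by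
  have hw : weight n ∈ generators n := Submodule.subset_span (by simp)
  refine Submodule.span_induction ?_ ?_ ?_ ?_ hX
  · rintro Y (rfl | rfl | rfl | rfl)
    · simp [Ring.lie_def]
    · rcases hA with rfl | rfl
      · simp
      · rw [← comm_skew, lie_raising_lowering]
        exact Submodule.neg_mem _ hw
    · rcases hA with rfl | rfl
      · rwa [lie_raising_lowering]
      · simp
    · rcases hA with rfl | rfl
      · rw [← comm_skew, lie_weight_raising]
        exact Submodule.neg_mem _ (Submodule.smul_mem _ _ raising_mem_generators)
      · rw [← comm_skew, lie_weight_lowering]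
        exact Submodule.neg_mem _ (Submodule.smul_mem _ _ lowering_mem_generators)
  · simp
  · intro X Y _ _ hX hY
    rw [comm_add]; exact Submodule.add_mem _ hX hY
  · intro c X _ hX
    rw [comm_smul]; exact Submodule.smul_mem _ c hX

/-- `ad A` is a derivation and preserves the space of generators, hence also its powers. -/
theorem lie_mem_errors {A : Op n} (hA : A = raising n ∨ A = lowering n) (t : ℕ) :
    ∀ {X : Op n}, X ∈ errors n t → ⁅A, X⁆ ∈ errors n t := by
  induction t with
  | zero =>
    intro X hX
    rw [errors, pow_zero, Submodule.mem_one] at hX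
    obtain ⟨c, rfl⟩ := hX
    rw [Algebra.algebraMap_eq_smul_one, comm_smul]
    simp [Ring.lie_def]
  | succ t ih =>
    intro X hX
    rw [errors, pow_succ] at hX ⊢
    refine Submodule.mul_induction_on hX (fun Y hY Z hZ => ?_) (fun Y Z hY hZ => ?_)
    · have h : ⁅A, Y * Z⁆ = ⁅A, Y⁆ * Z + Y * ⁅A, Z⁆ := by
        simp only [Ring.lie_def]; noncomm_ring
      rw [h]
      exact Submodule.add_mem _ (Submodule.mul_mem_mul (ih hY) hZ)
        (Submodule.mul_mem_mul hY (lie_mem_generators hA hZ))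
    · rw [comm_add]; exact Submodule.add_mem _ hY hZ

theorem conjTranspose_mem_generators {X : Op n} (hX : X ∈ generators n) :
    Xᴴ ∈ generators n := by
  refine Submodule.span_induction ?_ ?_ ?_ ?_ hX
  · rintro Y (rfl | rfl | rfl | rfl)
    · rw [Matrix.conjTranspose_one]; exact Submodule.subset_span (by simp)
    · rw [← lowering_eq]; exact lowering_mem_generators
    · rw [lowering_eq, Matrix.conjTranspose_conjTranspose]; exact raising_mem_generators
    · have h : (weight n)ᴴ = weight n := by
        rw [weight, Matrix.diagonal_conjTranspose]
        congr 1
        ext i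
        simp
      rw [h]; exact Submodule.subset_span (by simp)
  · simp
  · intro X Y _ _ hX hY
    rw [Matrix.conjTranspose_add]; exact Submodule.add_mem _ hX hY
  · intro c X _ hX
    rw [Matrix.conjTranspose_smul]; exact Submodule.smul_mem _ _ hX

theorem conjTranspose_mem_errors (t : ℕ) :
    ∀ {X : Op n}, X ∈ errors n t → Xᴴ ∈ errors n t := by
  induction t with
  | zero =>
    intro X hX
    rw [errors, pow_zero, Submodule.mem_one] at hX ⊢
    obtain ⟨c, rfl⟩ := hX
    exact ⟨star c, by simp [Algebra.algebraMap_eq_smul_one]⟩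
  | succ t ih =>
    intro X hX
    rw [errors, pow_succ] at hX
    rw [errors, pow_succ']
    refine Submodule.mul_induction_on hX (fun Y hY Z hZ => ?_) (fun Y Z hY hZ => ?_)
    · rw [Matrix.conjTranspose_mul]
      exact Submodule.mul_mem_mul (conjTranspose_mem_generators hZ) (ih hY)
    · rw [Matrix.conjTranspose_add]; exact Submodule.add_mem _ hY hZ

/-- The adjoint of `ad E` is `ad F` and conversely, and both preserve the smaller error spaces, so
the orthogonality condition is preserved as well. -/
theorem lie_mem_exactErrors {A : Op n} (hA : A = raising n ∨ A = lowering n) {t : ℕ} {X : Op n}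
    (hX : X ∈ exactErrors n t) : ⁅A, X⁆ ∈ exactErrors n t := by
  refine ⟨lie_mem_errors hA t hX.1, fun s hs' Y hY => ?_⟩
  change hs Y _ = 0
  rcases hA with rfl | rfl
  · rw [hs_lie_raising]; exact hX.2 s hs' _ (lie_mem_errors (Or.inr rfl) s hY)
  · rw [hs_lie_lowering]; exact hX.2 s hs' _ (lie_mem_errors (Or.inl rfl) s hY)

theorem hs_conjTranspose (X Y : Op n) : hs Xᴴ Yᴴ = hs Y X := by
  rw [hs, hs, Matrix.conjTranspose_conjTranspose, Matrix.trace_mul_comm]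

theorem conjTranspose_mem_exactErrors {t : ℕ} {X : Op n} (hX : X ∈ exactErrors n t) :
    Xᴴ ∈ exactErrors n t := by
  refine ⟨conjTranspose_mem_errors t hX.1, fun s hs' Y hY => ?_⟩
  change hs Y _ = 0
  rw [← Matrix.conjTranspose_conjTranspose Y, hs_conjTranspose, hs_eq_zero_comm]
  exact hX.2 s hs' _ (conjTranspose_mem_errors s hY)

theorem hs_eq_zero_of_mem_exactErrors {s t : ℕ} (hst : s ≠ t) {X Y : Op n}
    (hX : X ∈ exactErrors n s) (hY : Y ∈ exactErrors n t) : hs X Y = 0 := by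
  rcases hst.lt_or_gt with h | h
  · exact hY.2 s h X hX.1
  · rw [hs_eq_zero_comm]; exact hX.2 t h Y hY.1

/-- Products of `t` generators raise the index by at most `t`. -/
theorem entry_eq_zero_of_mem_errors (t : ℕ) : ∀ {X : Op n}, X ∈ errors n t →
    ∀ {i j : ℕ}, j + t < i → entry X i j = 0 := by
  have hg : ∀ {X : Op n}, X ∈ generators n → ∀ {i j : ℕ}, j + 1 < i → entry X i j = 0 := by
    intro X hX i j hij
    refine Submodule.span_induction ?_ ?_ ?_ ?_ hX
    · rintro Y (rfl | rfl | rfl | rfl)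
      · by_cases hi : i ≤ n
        · rw [entry_one i j hi, if_neg (by omega)]
        · rw [entry_of_lt_left _ _ (by omega)]
      · rw [entry_raising, if_neg (by omega)]
      · rw [lowering_eq, entry_conjTranspose, entry_raising, if_neg (by omega), star_zero]
      · rw [← mul_one (weight n), entry_weight_mul]
        by_cases hi : i ≤ n
        · rw [entry_one i j hi, if_neg (by omega), mul_zero]
        · rw [entry_of_lt_left _ _ (by omega), mul_zero]
    · simp
    · intro X Y _ _ hX hY
      rw [entry_add, hX, hY, add_zero]
    · intro c X _ hX
      rw [entry_smul, hX, mul_zero]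
  induction t with
  | zero =>
    intro X hX i j hij
    rw [errors, pow_zero, Submodule.mem_one] at hX
    obtain ⟨c, rfl⟩ := hX
    rw [Algebra.algebraMap_eq_smul_one, entry_smul]
    by_cases hi : i ≤ n
    · rw [entry_one i j hi, if_neg (by omega), mul_zero]
    · rw [entry_of_lt_left _ _ (by omega), mul_zero]
  | succ t ih =>
    intro X hX i j hij
    rw [errors, pow_succ] at hX
    refine Submodule.mul_induction_on hX (fun Y hY Z hZ => ?_) (fun Y Z hY hZ => ?_)
    · rw [entry_mul, Finset.sum_eq_zero]
      intro k _
      by_cases hk : k + t < i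
      · rw [ih hY hk, zero_mul]
      · rw [hg hZ (by omega), mul_zero]
    · rw [entry_add, hY, hZ, add_zero]

/-! ### Irreducible tensor operators -/

/-- The vectors `(ad F)^m (E^t)` of the irreducible `𝔰𝔩(2)`-module of operators generated by the
highest weight vector `E^t`. -/
noncomputable def tensor (n t : ℕ) : ℕ → Op n
  | 0 => raising n ^ t
  | m + 1 => ⁅lowering n, tensor n t m⁆

theorem entry_raising_pow (t i j : ℕ) : entry (raising n ^ t) i j =
    if i = j + t ∧ i ≤ n then ∏ l ∈ Finset.range t, raisingCoeff n (j + l) else 0 := by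
  induction t generalizing i with
  | zero =>
    rw [pow_zero]
    by_cases hi : i ≤ n
    · simp [entry_one i j hi, hi]
    · rw [entry_of_lt_left _ _ (by omega), if_neg (by omega)]
  | succ t ih =>
    rw [pow_succ']
    rcases i with _ | i
    · rw [entry_raising_mul_zero, if_neg (by omega)]
    · rw [entry_raising_mul_succ, ih]
      rcases lt_trichotomy i n with h | h | h
      · by_cases h2 : i = j + t
        · rw [if_pos (by omega), if_pos (by omega), Finset.prod_range_succ, h2, mul_comm]
        · rw [if_neg (by omega), if_neg (by omega), mul_zero]
      · rw [h, raisingCoeff_self, zero_mul, if_neg (by omega)]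
      · rw [if_neg (by omega), if_neg (by omega), mul_zero]

theorem entry_raising_pow_zero_ne_zero {t : ℕ} (ht : t ≤ n) :
    entry (raising n ^ t) t 0 ≠ 0 := by
  rw [entry_raising_pow, if_pos (by omega), Finset.prod_ne_zero_iff]
  intro l hl
  rw [Finset.mem_range] at hl
  exact raisingCoeff_ne_zero (by omega)

theorem entry_lie_lowering_zero (X : Op n) (i : ℕ) :
    entry ⁅lowering n, X⁆ i 0 = raisingCoeff n i * entry X (i + 1) 0 := by
  rw [Ring.lie_def, entry_sub, entry_lowering_mul, entry_mul_lowering_zero, sub_zero]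

theorem entry_lie_lowering_succ (X : Op n) (i j : ℕ) : entry ⁅lowering n, X⁆ i (j + 1) =
    raisingCoeff n i * entry X (i + 1) (j + 1) - entry X i j * raisingCoeff n j := by
  rw [Ring.lie_def, entry_sub, entry_lowering_mul, entry_mul_lowering_succ]

theorem entry_tensor_eq_zero (t m : ℕ) : ∀ {i j : ℕ}, i + m ≠ j + t →
    entry (tensor n t m) i j = 0 := by
  induction m with
  | zero =>
    intro i j h
    rw [tensor, entry_raising_pow, if_neg (by omega)]
  | succ m ih =>
    intro i j h
    rw [tensor]
    rcases j with _ | j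
    · rw [entry_lie_lowering_zero, ih (by omega), mul_zero]
    · rw [entry_lie_lowering_succ, ih (by omega), ih (by omega), mul_zero, zero_mul, sub_zero]

theorem lie_weight_tensor (t m : ℕ) :
    ⁅weight n, tensor n t m⁆ = (2 * (t - m) : ℂ) • tensor n t m := by
  refine ext_entry fun i j => ?_
  rw [entry_lie_weight, entry_smul]
  by_cases h : i + m = j + t
  · have h' : (i : ℂ) + m = j + t := by exact_mod_cast h
    linear_combination 2 * entry (tensor n t m) i j * h'
  · rw [entry_tensor_eq_zero t m h, mul_zero, mul_zero]

theorem lie_raising_tensor_zero (t : ℕ) : ⁅raising n, tensor n t 0⁆ = 0 := by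
  rw [tensor, Ring.lie_def, ← pow_succ, ← pow_succ', sub_self]

/-- The standard ladder relation for a highest weight vector of weight `2 t`; it makes the norms
below computable. -/
theorem lie_raising_tensor_succ (t m : ℕ) :
    ⁅raising n, tensor n t (m + 1)⁆ = ((m + 1) * (2 * t - m) : ℂ) • tensor n t m := by
  induction m with
  | zero =>
    rw [show tensor n t (0 + 1) = ⁅lowering n, tensor n t 0⁆ from rfl, comm_comm,
      lie_raising_lowering, lie_raising_tensor_zero, comm_zero,
      lie_weight_tensor, add_zero]
    congr 1
    push_cast; ring
  | succ m ih =>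
    rw [tensor, comm_comm, lie_raising_lowering, ih, comm_smul, lie_weight_tensor,
      show ⁅lowering n, tensor n t m⁆ = tensor n t (m + 1) from rfl, ← add_smul]
    congr 1
    push_cast; ring

theorem tensor_mem_errors (t m : ℕ) : tensor n t m ∈ errors n t := by
  induction m with
  | zero => exact Submodule.pow_mem_pow _ raising_mem_generators t
  | succ m ih => exact lie_mem_errors (Or.inr rfl) t ih

/-- `E^t` is supported on the `t`-th subdiagonal, where products of fewer than `t` generators
vanish. Applying `ad F` keeps the orthogonality. -/
theorem tensor_mem_exactErrors (t m : ℕ) : tensor n t m ∈ exactErrors n t := by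
  induction m with
  | zero =>
    refine ⟨tensor_mem_errors t 0, fun s hst Y hY => ?_⟩
    change hs Y _ = 0
    rw [hs_eq_sum]
    refine Finset.sum_eq_zero fun j _ => Finset.sum_eq_zero fun i _ => ?_
    by_cases h : i + 0 = j + t
    · rw [entry_eq_zero_of_mem_errors s hY (by omega), star_zero, zero_mul]
    · rw [entry_tensor_eq_zero t 0 h, mul_zero]
  | succ m ih => exact lie_mem_exactErrors (Or.inr rfl) ih

theorem hs_tensor_of_ne {t m l : ℕ} (h : m ≠ l) : hs (tensor n t m) (tensor n t l) = 0 := by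
  rw [hs_eq_sum]
  refine Finset.sum_eq_zero fun j _ => Finset.sum_eq_zero fun i _ => ?_
  by_cases h' : i + m = j + t
  · rw [entry_tensor_eq_zero t l (by omega), mul_zero]
  · rw [entry_tensor_eq_zero t m h', star_zero, zero_mul]

/-- The squared Hilbert-Schmidt norm of `tensor n t m`. -/
noncomputable def tensorNorm (n t m : ℕ) : ℂ := hs (tensor n t m) (tensor n t m)

theorem tensorNorm_succ (t m : ℕ) :
    tensorNorm n t (m + 1) = (m + 1) * (2 * t - m) * tensorNorm n t m := by
  rw [tensorNorm, tensor, hs_lie_lowering,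
    show ⁅lowering n, tensor n t m⁆ = tensor n t (m + 1) from rfl, lie_raising_tensor_succ,
    hs_smul_left, tensorNorm]
  simp

theorem tensorNorm_mul_factorial (t m : ℕ) (hm : m ≤ 2 * t) :
    tensorNorm n t m * ((2 * t - m).factorial : ℂ) =
      m.factorial * (2 * t).factorial * tensorNorm n t 0 := by
  induction m with
  | zero => simp [mul_comm]
  | succ m ih =>
    rw [tensorNorm_succ, Nat.factorial_succ m]
    have h : ((2 * t - m).factorial : ℂ) = (2 * t - m) * (2 * t - (m + 1)).factorial := by
      rw [show 2 * t - m = (2 * t - (m + 1)) + 1 by omega, Nat.factorial_succ,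
        show 2 * t - (m + 1) + 1 = 2 * t - m by omega, Nat.cast_mul, Nat.cast_sub (by omega)]
      push_cast
      rfl
    have h2 := ih (by omega)
    rw [h] at h2
    push_cast
    linear_combination ((m : ℂ) + 1) * h2

theorem tensorNorm_ne_zero {t m : ℕ} (ht : t ≤ n) (hm : m ≤ 2 * t) : tensorNorm n t m ≠ 0 := by
  have h0 : tensorNorm n t 0 ≠ 0 := by
    rw [tensorNorm, Ne, hs_self_eq_zero]
    intro h
    apply entry_raising_pow_zero_ne_zero ht
    rw [show raising n ^ t = tensor n t 0 from rfl, h, entry_zero]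
  intro h
  have h1 := tensorNorm_mul_factorial (n := n) t m hm
  rw [h, zero_mul, eq_comm] at h1
  simp [h0, Nat.factorial_ne_zero] at h1

theorem hs_tensor (a b : (t : Fin (n + 1)) × Fin (2 * t + 1)) :
    hs (tensor n a.1 a.2) (tensor n b.1 b.2) = if a = b then tensorNorm n a.1 a.2 else 0 := by
  split_ifs with h
  · rw [h]; rfl
  · obtain ⟨t, m⟩ := a
    obtain ⟨s, l⟩ := b
    by_cases hts : t = s
    · subst hts
      refine hs_tensor_of_ne fun hml => h ?_
      exact congrArg _ (Fin.ext hml)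
    · exact hs_eq_zero_of_mem_exactErrors (fun h' => hts (Fin.ext h'))
        (tensor_mem_exactErrors _ _) (tensor_mem_exactErrors _ _)

/-- The tensors are nonzero and pairwise orthogonal, and there are `∑ (2 t + 1) = (n + 1)²` of them.
-/
theorem span_tensor : Submodule.span ℂ (Set.range
    fun a : (t : Fin (n + 1)) × Fin (2 * t + 1) => tensor n a.1 a.2) = ⊤ := by
  apply LinearIndependent.span_eq_top_of_card_eq_finrank'
  · rw [Fintype.linearIndependent_iff]
    intro g hg a
    have h := congrArg (hs (tensor n a.1 a.2)) hg
    simp only [hs_sum_right, hs_smul_right, hs_tensor, mul_ite, mul_zero, hs_zero_right,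
      Finset.sum_ite_eq, Finset.mem_univ, if_true] at h
    exact (mul_eq_zero.mp h).resolve_right (tensorNorm_ne_zero (by omega) (by omega))
  · rw [Module.finrank_matrix, Fintype.card_sigma]
    simp only [Fintype.card_fin, Module.finrank_self, mul_one]
    rw [Fin.sum_univ_eq_sum_range (fun t => 2 * t + 1)]
    induction n + 1 with
    | zero => rfl
    | succ k ih => rw [Finset.sum_range_succ, ih]; ring

theorem span_tensor_eq_exactErrors {t : ℕ} (ht : t ≤ n) :
    Submodule.span ℂ (Set.range fun m : Fin (2 * t + 1) => tensor n t m) = exactErrors n t := by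
  apply le_antisymm
  · rw [Submodule.span_le]
    rintro _ ⟨m, rfl⟩
    exact tensor_mem_exactErrors t m
  · intro X hX
    have h : X ∈ Submodule.span ℂ (Set.range
        fun a : (t : Fin (n + 1)) × Fin (2 * t + 1) => tensor n a.1 a.2) := by
      rw [span_tensor]; trivial
    rw [Submodule.mem_span_range_iff_exists_fun] at h
    obtain ⟨c, hc⟩ := h
    rw [← hc]
    refine Submodule.sum_mem _ fun a _ => ?_
    by_cases ha : (a.1 : ℕ) = t
    · obtain ⟨s, m⟩ := a
      subst ha
      exact Submodule.smul_mem _ _ (Submodule.subset_span ⟨m, rfl⟩)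
    · have h := congrArg (hs (tensor n a.1 a.2)) hc
      simp only [hs_sum_right, hs_smul_right, hs_tensor, mul_ite, mul_zero,
        Finset.sum_ite_eq, Finset.mem_univ, if_true] at h
      rw [hs_eq_zero_of_mem_exactErrors ha (tensor_mem_exactErrors _ _) hX, mul_eq_zero] at h
      rw [h.resolve_right (tensorNorm_ne_zero (by omega) (by omega)), zero_smul]
      exact Submodule.zero_mem _

/-! ### The superoperators in the tensor basis -/

theorem superPi_eq_sum (t : ℕ) (X : Op n) :
    superPi n t X = ∑ i, hs (errorBasis n t i) X • errorBasis n t i := rfl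

theorem hs_errorBasis (t : ℕ) (i j) :
    hs (errorBasis n t i) (errorBasis n t j) = if i = j then 1 else 0 :=
  (errorBasis_spec n t).1 i j

theorem errorBasis_mem (t : ℕ) (i) : errorBasis n t i ∈ exactErrors n t := by
  rw [← (errorBasis_spec n t).2]
  exact Submodule.subset_span ⟨i, rfl⟩

theorem superPi_mem (t : ℕ) (X : Op n) : superPi n t X ∈ exactErrors n t :=
  Submodule.sum_mem _ fun i _ => Submodule.smul_mem _ _ (errorBasis_mem t i)

theorem hs_superPi {t : ℕ} {Y : Op n} (hY : Y ∈ exactErrors n t) (X : Op n) :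
    hs Y (superPi n t X) = hs Y X := by
  rw [← (errorBasis_spec n t).2] at hY
  refine Submodule.span_induction ?_ ?_ ?_ ?_ hY
  · rintro _ ⟨i, rfl⟩
    simp [superPi_eq_sum, hs_sum_right, hs_smul_right, hs_errorBasis]
  · simp
  · intro Y Z _ _ hY hZ
    rw [hs_add_left, hs_add_left, hY, hZ]
  · intro c Y _ hY
    rw [hs_smul_left, hs_smul_left, hY]

theorem superPi_eq_of_mem {t : ℕ} {X Z : Op n} (hZ : Z ∈ exactErrors n t)
    (h : ∀ Y ∈ exactErrors n t, hs Y Z = hs Y X) : superPi n t X = Z := by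
  rw [← sub_eq_zero, ← hs_self_eq_zero]
  have hm := Submodule.sub_mem _ (superPi_mem t X) hZ
  rw [hs_sub_right, hs_superPi hm, h _ hm, sub_self]

theorem superPi_of_mem {t : ℕ} {X : Op n} (hX : X ∈ exactErrors n t) : superPi n t X = X :=
  superPi_eq_of_mem hX fun _ _ => rfl

theorem superPi_of_mem_of_ne {s t : ℕ} (hst : s ≠ t) {X : Op n} (hX : X ∈ exactErrors n s) :
    superPi n t X = 0 :=
  superPi_eq_of_mem (Submodule.zero_mem _) fun Y hY => by
    rw [hs_zero_right, hs_eq_zero_of_mem_exactErrors hst.symm hY hX]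

theorem superPi_add (t : ℕ) (X Y : Op n) :
    superPi n t (X + Y) = superPi n t X + superPi n t Y := by
  simp [superPi_eq_sum, hs_add_right, add_smul, Finset.sum_add_distrib]

theorem superPi_smul (t : ℕ) (c : ℂ) (X : Op n) : superPi n t (c • X) = c • superPi n t X := by
  simp [superPi_eq_sum, hs_smul_right, mul_smul, Finset.smul_sum]

theorem superPhi_add (t : ℕ) (X Y : Op n) :
    superPhi n t (X + Y) = superPhi n t X + superPhi n t Y := by
  simp [superPhi, Matrix.mul_add, Matrix.add_mul, Finset.sum_add_distrib]

theorem superPhi_smul (t : ℕ) (c : ℂ) (X : Op n) : superPhi n t (c • X) = c • superPhi n t X := by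
  simp [superPhi, Finset.smul_sum]

/-- To prove an identity of linear maps it suffices to check the tensors. -/
theorem tensor_induction {p : Op n → Prop} (h0 : p 0)
    (hadd : ∀ X Y, p X → p Y → p (X + Y)) (hsmul : ∀ (c : ℂ) X, p X → p (c • X))
    (ht : ∀ (t : Fin (n + 1)) (m : ℕ), p (tensor n t m)) (X : Op n) : p X := by
  have h : X ∈ Submodule.span ℂ (Set.range
      fun a : (t : Fin (n + 1)) × Fin (2 * t + 1) => tensor n a.1 a.2) := by
    rw [span_tensor]; trivial
  refine Submodule.span_induction ?_ h0 (fun X Y _ _ => hadd X Y) (fun c X _ => hsmul c X) h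
  rintro _ ⟨a, rfl⟩
  exact ht a.1 a.2

theorem sum_superPi (X : Op n) : ∑ t : Fin (n + 1), superPi n t X = X := by
  induction X using tensor_induction with
  | h0 => exact Finset.sum_eq_zero fun t _ => superPi_of_mem (Submodule.zero_mem _)
  | hadd X Y hX hY => simp only [superPi_add, Finset.sum_add_distrib, hX, hY]
  | hsmul c X hX => rw [← Finset.sum_congr rfl fun _ _ => (superPi_smul _ c X).symm,
      ← Finset.smul_sum, hX]
  | ht t m =>
    rw [Finset.sum_eq_single t, superPi_of_mem (tensor_mem_exactErrors _ _)]
    · intro s _ hs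
      exact superPi_of_mem_of_ne (fun h => hs (Fin.ext h.symm)) (tensor_mem_exactErrors _ _)
    · simp

theorem superPi_eq_tensor {t : ℕ} (ht : t ≤ n) (X : Op n) : superPi n t X =
    ∑ m : Fin (2 * t + 1), (tensorNorm n t m)⁻¹ • hs (tensor n t m) X • tensor n t m := by
  apply superPi_eq_of_mem
  · exact Submodule.sum_mem _ fun m _ => Submodule.smul_mem _ _
      (Submodule.smul_mem _ _ (tensor_mem_exactErrors _ _))
  · intro Y hY
    rw [← span_tensor_eq_exactErrors ht] at hY
    refine Submodule.span_induction ?_ ?_ ?_ ?_ hY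
    · rintro _ ⟨l, rfl⟩
      simp only [hs_sum_right, hs_smul_right]
      rw [Finset.sum_eq_single l]
      · rw [mul_left_comm, show hs (tensor n t l) (tensor n t l) = tensorNorm n t l from rfl,
          inv_mul_cancel₀ (tensorNorm_ne_zero ht (by omega)), mul_one]
      · intro m _ hm
        rw [hs_tensor_of_ne (fun h => hm (Fin.ext h.symm)), mul_zero, mul_zero]
      · simp
    · simp
    · intro Y Z _ _ hY hZ
      rw [hs_add_left, hs_add_left, hY, hZ]
    · intro c Y _ hY
      rw [hs_smul_left, hs_smul_left, hY]

/-- The superoperator `X ↦ ∑ c_i B_i X B_iᴴ` is determined by `X ↦ ∑ c_i tr (B_iᴴ X) B_i`. -/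
theorem sum_sandwich_apply {ι : Type*} [Fintype ι] (c : ι → ℂ) (b : ι → Op n) (X : Op n)
    (p r : Fin (n + 1)) :
    (∑ i, c i • (b i * X * (b i)ᴴ)) p r =
      ∑ s, ∑ q, X q s * (∑ i, c i • hs (b i) (Matrix.single r s 1) • b i) p q := by
  simp only [Matrix.sum_apply, Matrix.smul_apply, Matrix.mul_apply, smul_eq_mul,
    Matrix.conjTranspose_apply, hs, Matrix.trace_mul_single, Finset.mul_sum, Finset.sum_mul,
    MulOpposite.op_one, one_smul]
  rw [Finset.sum_comm]
  refine Finset.sum_congr rfl fun s _ => ?_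
  rw [Finset.sum_comm]
  refine Finset.sum_congr rfl fun q _ => Finset.sum_congr rfl fun i _ => ?_
  ring

/-- `Φ_t` and `Π_t` encode the same four-index array `∑ B ⊗ B̄` with its indices paired differently.
So the change of basis already known for `Π_t` carries over to `Φ_t`. -/
theorem superPhi_eq_tensor {t : ℕ} (ht : t ≤ n) (X : Op n) : superPhi n t X =
    ∑ m : Fin (2 * t + 1), (tensorNorm n t m)⁻¹ • (tensor n t m * X * (tensor n t m)ᴴ) := by
  have h := sum_sandwich_apply (fun _ => 1) (errorBasis n t) X
  simp only [one_smul, ← superPi_eq_sum, superPi_eq_tensor ht] at h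
  ext p r
  rw [superPhi, h, sum_sandwich_apply]

/-! ### Equivariance and Schur's lemma -/

/-- The Leibniz rule for `ad A` on `B X Bᴴ` leaves two extra terms. Summed over an orthonormal basis
they cancel, because the matrix of `ad Aᴴ` is the conjugate transpose of that of `ad A`. -/
theorem superPhi_comm {A : Op n} (hA : A = raising n ∨ A = lowering n) (t : ℕ) (X : Op n) :
    superPhi n t ⁅A, X⁆ = ⁅A, superPhi n t X⁆ := by
  have hA' : Aᴴ = raising n ∨ Aᴴ = lowering n := by
    rcases hA with rfl | rfl
    · right; rw [lowering_eq]
    · left; rw [lowering_eq, Matrix.conjTranspose_conjTranspose]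
  have hadj : ∀ Y Z : Op n, hs Y ⁅A, Z⁆ = hs ⁅Aᴴ, Y⁆ Z := by
    intro Y Z
    rcases hA with rfl | rfl
    · rw [hs_lie_raising, lowering_eq]
    · rw [hs_lie_lowering, lowering_eq, Matrix.conjTranspose_conjTranspose]
  set b := errorBasis n t with hb
  have h1 : ∀ B : Op n, ⁅A, B * X * Bᴴ⁆ =
      B * ⁅A, X⁆ * Bᴴ + (⁅A, B⁆ * X * Bᴴ - B * X * ⁅Aᴴ, B⁆ᴴ) := by
    intro B
    simp only [Ring.lie_def, Matrix.conjTranspose_sub, Matrix.conjTranspose_mul,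
      Matrix.conjTranspose_conjTranspose]
    noncomm_ring
  have h2 : ⁅A, superPhi n t X⁆ = ∑ i, ⁅A, b i * X * (b i)ᴴ⁆ := by
    simp only [superPhi, Ring.lie_def, Matrix.mul_sum, Matrix.sum_mul, Finset.sum_sub_distrib]
    rfl
  have h3 : ∑ i, ⁅A, b i⁆ * X * (b i)ᴴ = ∑ j, b j * X * ⁅Aᴴ, b j⁆ᴴ := by
    have e1 : ∀ i, ⁅A, b i⁆ = ∑ j, hs (b j) ⁅A, b i⁆ • b j := fun i =>
      (superPi_of_mem (lie_mem_exactErrors hA (errorBasis_mem t i))).symm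
    have e2 : ∀ j, ⁅Aᴴ, b j⁆ᴴ = ∑ i, hs (b j) ⁅A, b i⁆ • (b i)ᴴ := fun j => by
      rw [← superPi_of_mem (lie_mem_exactErrors hA' (errorBasis_mem t j)), superPi_eq_sum,
        Matrix.conjTranspose_sum]
      simp only [Matrix.conjTranspose_smul, star_hs, hadj]
      rfl
    calc ∑ i, ⁅A, b i⁆ * X * (b i)ᴴ
        = ∑ i, ∑ j, hs (b j) ⁅A, b i⁆ • (b j * X * (b i)ᴴ) := by
          refine Finset.sum_congr rfl fun i _ => ?_
          conv_lhs => rw [e1 i]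
          simp only [Matrix.sum_mul, Matrix.smul_mul]
      _ = ∑ j, ∑ i, hs (b j) ⁅A, b i⁆ • (b j * X * (b i)ᴴ) := Finset.sum_comm
      _ = ∑ j, b j * X * ⁅Aᴴ, b j⁆ᴴ := by
          refine Finset.sum_congr rfl fun j _ => ?_
          rw [e2 j]
          simp only [Matrix.mul_sum, Matrix.mul_smul]
  rw [h2, Finset.sum_congr rfl fun i _ => h1 (b i), Finset.sum_add_distrib,
    Finset.sum_sub_distrib, h3, sub_self, add_zero]
  rfl

theorem superPhi_comm_weight (t : ℕ) (X : Op n) :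
    superPhi n t ⁅weight n, X⁆ = ⁅weight n, superPhi n t X⁆ := by
  have h : ∀ Y : Op n, ⁅weight n, Y⁆ =
      ⁅raising n, ⁅lowering n, Y⁆⁆ + (-1 : ℂ) • ⁅lowering n, ⁅raising n, Y⁆⁆ := by
    intro Y
    rw [comm_comm (raising n), lie_raising_lowering]
    module
  rw [h, h, superPhi_add, superPhi_smul, superPhi_comm (Or.inl rfl), superPhi_comm (Or.inr rfl),
    superPhi_comm (Or.inr rfl), superPhi_comm (Or.inl rfl)]

/-- An operator of weight `2 j` that commutes with the raising operator is a multiple of `E^j`. -/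
theorem eq_smul_raising_pow {j : ℕ} (hj : j ≤ n) {X : Op n} (hE : ⁅raising n, X⁆ = 0)
    (hH : ⁅weight n, X⁆ = (2 * j : ℂ) • X) :
    X = (entry X j 0 / entry (raising n ^ j) j 0) • raising n ^ j := by
  set Z := X - (entry X j 0 / entry (raising n ^ j) j 0) • raising n ^ j with hZ
  suffices h : Z = 0 from sub_eq_zero.mp h
  have hX : ∀ i k, i ≠ k + j → entry X i k = 0 := by
    intro i k hik
    have h := congrArg (fun Y => entry Y i k) hH
    simp only [entry_lie_weight, entry_smul] at h
    have h' : 2 * ((i : ℂ) - k - j) * entry X i k = 0 := by linear_combination h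
    refine (mul_eq_zero.mp h').resolve_left fun h0 => hik ?_
    have : (i : ℂ) = k + j := by linear_combination h0 / 2
    exact_mod_cast this
  have hZE : raising n * Z = Z * raising n := by
    have h1 : ⁅raising n, Z⁆ = 0 := by
      have h0 := lie_raising_tensor_zero (n := n) j
      rw [tensor] at h0
      have h2 : Z = X + (-(entry X j 0 / entry (raising n ^ j) j 0)) • raising n ^ j := by
        rw [hZ, neg_smul, sub_eq_add_neg]
      rw [h2, comm_add, comm_smul, hE, h0]
      simp
    exact sub_eq_zero.mp h1
  -- Subtracting the multiple of `E^j` kills the entry in column `0`; commuting with `E` propagates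
  -- this zero along the diagonal.
  have hZ0 : ∀ k, entry Z (k + j) k = 0 := by
    intro k
    induction k with
    | zero =>
      rw [zero_add, hZ, entry_sub, entry_smul, div_mul_cancel₀ _ (entry_raising_pow_zero_ne_zero hj),
        sub_self]
    | succ k ih =>
      by_cases hk : k < n
      · have h := congrArg (fun Y => entry Y (k + j + 1) k) hZE
        simp only [entry_raising_mul_succ, entry_mul_raising, ih, mul_zero] at h
        rw [show k + 1 + j = k + j + 1 by ring]
        exact (mul_eq_zero.mp h.symm).resolve_right (raisingCoeff_ne_zero hk)
      · exact entry_of_lt_right _ _ (by omega)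
  refine ext_entry fun i k => ?_
  rw [entry_zero]
  by_cases hik : i = k + j
  · rw [hik, hZ0]
  · rw [hZ, entry_sub, entry_smul, hX i k hik, entry_raising_pow _ i k, if_neg (by tauto),
      mul_zero, sub_zero]

/-- The eigenvalue of `Φ_t` on the errors of distance exactly `j`. -/
noncomputable def phiEigenvalue (n t j : ℕ) : ℂ :=
  entry (superPhi n t (raising n ^ j)) j 0 / entry (raising n ^ j) j 0

/-- Schur's lemma by hand: `Φ_t(E^j)` is again a highest weight vector of weight `2 j`, hence a
multiple of `E^j`, and `ad F` transports the scalar to the other tensors. -/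
theorem superPhi_tensor (t : ℕ) {j : ℕ} (hj : j ≤ n) (m : ℕ) :
    superPhi n t (tensor n j m) = phiEigenvalue n t j • tensor n j m := by
  induction m with
  | zero =>
    apply eq_smul_raising_pow hj
    · rw [← superPhi_comm (Or.inl rfl), lie_raising_tensor_zero]
      simp [superPhi]
    · rw [← superPhi_comm_weight, lie_weight_tensor, superPhi_smul]
      simp
  | succ m ih =>
    rw [tensor, superPhi_comm (Or.inr rfl), ih, comm_smul]

theorem superPhi_of_mem (t : ℕ) {j : ℕ} (hj : j ≤ n) {X : Op n} (hX : X ∈ exactErrors n j) :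
    superPhi n t X = phiEigenvalue n t j • X := by
  rw [← span_tensor_eq_exactErrors hj] at hX
  refine Submodule.span_induction ?_ ?_ ?_ ?_ hX
  · rintro _ ⟨m, rfl⟩
    exact superPhi_tensor t hj m
  · simp [superPhi]
  · intro X Y _ _ hX hY
    rw [superPhi_add, hX, hY, smul_add]
  · intro c X _ hX
    rw [superPhi_smul, hX, smul_comm]

theorem star_hs_superPhi (t : ℕ) (X : Op n) :
    star (hs X (superPhi n t X)) = hs Xᴴ (superPhi n t Xᴴ) := by
  simp only [superPhi, hs_sum_right, star_sum]
  refine Finset.sum_congr rfl fun i _ => ?_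
  rw [star_hs, hs, hs, Matrix.conjTranspose_mul, Matrix.conjTranspose_mul,
    Matrix.conjTranspose_conjTranspose, Matrix.conjTranspose_conjTranspose,
    Matrix.trace_mul_comm X]
  simp only [Matrix.mul_assoc]

/-- `V_j` is closed under `ᴴ`, and conjugating `⟨X, Φ_t X⟩` amounts to replacing `X` by `Xᴴ`. -/
theorem star_phiEigenvalue (t : ℕ) {j : ℕ} (hj : j ≤ n) :
    star (phiEigenvalue n t j) = phiEigenvalue n t j := by
  have hX := tensor_mem_exactErrors (n := n) j 0
  have h := star_hs_superPhi t (tensor n j 0)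
  rw [superPhi_of_mem t hj hX, superPhi_of_mem t hj (conjTranspose_mem_exactErrors hX),
    hs_smul_right, hs_smul_right, star_mul', star_hs, hs_conjTranspose] at h
  exact mul_right_cancel₀ (tensorNorm_ne_zero hj (Nat.zero_le _)) h

theorem ofReal_re_phiEigenvalue (t : ℕ) {j : ℕ} (hj : j ≤ n) :
    ((phiEigenvalue n t j).re : ℂ) = phiEigenvalue n t j :=
  Complex.conj_eq_iff_re.mp (star_phiEigenvalue t hj)

theorem isWCoeff_phiEigenvalue (n : ℕ) : IsWCoeff n fun t j => (phiEigenvalue n t j).re := by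
  intro t X
  have h : superPhi n t X = superPhi n t (∑ j : Fin (n + 1), superPi n j X) := by rw [sum_superPi]
  have hsum : ∀ (s : Finset (Fin (n + 1))) (f : Fin (n + 1) → Op n),
      superPhi n t (∑ j ∈ s, f j) = ∑ j ∈ s, superPhi n t (f j) := by
    intro s f
    simp only [superPhi, Matrix.mul_sum, Matrix.sum_mul]
    exact Finset.sum_comm
  rw [h, hsum]
  refine Finset.sum_congr rfl fun j _ => ?_
  rw [superPhi_of_mem t (by omega) (superPi_mem _ X), ofReal_re_phiEigenvalue t (by omega)]

/-- Uniqueness of the coefficients, so that every `W` allowed in `IsFeasible` is the explicit one.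
-/
theorem IsWCoeff.eq_phiEigenvalue {W : Fin (n + 1) → Fin (n + 1) → ℝ} (hW : IsWCoeff n W)
    (t j : Fin (n + 1)) : (W t j : ℂ) = phiEigenvalue n t j := by
  have h := hW t (tensor n j 0)
  rw [superPhi_tensor t (by omega), Finset.sum_eq_single j,
    superPi_of_mem (tensor_mem_exactErrors _ _)] at h
  · refine (smul_left_injective ℂ (M := Op n) (m := tensor n j 0) ?_ h).symm
    intro h0
    exact tensorNorm_ne_zero (n := n) (t := j) (m := 0) (by omega) (Nat.zero_le _)
      (by rw [tensorNorm, h0, hs_zero_right])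
  · intro i _ hi
    rw [superPi_of_mem_of_ne (fun h => hi (Fin.ext h.symm)) (tensor_mem_exactErrors _ _),
      smul_zero]
  · simp

/-! ### Explicit eigenvalues -/

theorem entry_sum {ι : Type*} (s : Finset ι) (f : ι → Op n) (i j : ℕ) :
    entry (∑ m ∈ s, f m) i j = ∑ m ∈ s, entry (f m) i j := by
  classical
  induction s using Finset.induction_on with
  | empty => simp
  | insert a s ha ih => rw [Finset.sum_insert ha, Finset.sum_insert ha, entry_add, ih]

/-- Convolution of binomials, by Pascal's rule and induction on `n`; with `a = t` it sums the
squared entries of `E^t`. -/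
theorem sum_choose_mul_choose (t n : ℕ) : ∀ a : ℕ,
    ∑ j ∈ Finset.range (n + 1), (n - j).choose a * (j + t).choose t =
      (n + t + 1).choose (a + t + 1) := by
  induction n with
  | zero =>
    rintro (_ | a)
    · simp
    · simp [Nat.choose_eq_zero_of_lt]
  | succ n ih =>
    rintro (_ | a)
    · simp only [Nat.choose_zero_right, one_mul, zero_add]
      exact Nat.sum_range_add_choose (n + 1) t
    · rw [Finset.sum_range_succ, Nat.sub_self, Nat.choose_zero_succ, zero_mul, add_zero]
      have h : ∀ j ∈ Finset.range (n + 1), (n + 1 - j).choose (a + 1) * (j + t).choose t =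
          (n - j).choose a * (j + t).choose t + (n - j).choose (a + 1) * (j + t).choose t := by
        intro j hj
        rw [Finset.mem_range] at hj
        rw [show n + 1 - j = (n - j) + 1 by omega, Nat.choose_succ_succ, add_mul]
      rw [Finset.sum_congr rfl h, Finset.sum_add_distrib, ih, ih,
        show n + 1 + t + 1 = (n + t + 1) + 1 by ring,
        show a + 1 + t + 1 = (a + t + 1) + 1 by ring, Nat.choose_succ_succ (n + t + 1)]

theorem prod_raisingCoeff_sq {t j : ℕ} (h : j + t ≤ n) :
    (∏ l ∈ Finset.range t, raisingCoeff n (j + l)) *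
      (∏ l ∈ Finset.range t, raisingCoeff n (j + l)) =
      (t.factorial : ℂ) ^ 2 * ((n - j).choose t * (j + t).choose t : ℕ) := by
  have h1 : (∏ l ∈ Finset.range t, ((n : ℂ) - (j + l : ℕ))) = ((n - j).descFactorial t : ℂ) := by
    rw [Nat.descFactorial_eq_prod_range, Nat.cast_prod]
    refine Finset.prod_congr rfl fun l hl => ?_
    rw [Finset.mem_range] at hl
    rw [Nat.sub_sub, Nat.cast_sub (by omega)]
  have h2 : (∏ l ∈ Finset.range t, (((j + l : ℕ) : ℂ) + 1)) =
      ((j + 1).ascFactorial t : ℂ) := by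
    rw [Nat.ascFactorial_eq_prod_range, Nat.cast_prod]
    refine Finset.prod_congr rfl fun l _ => ?_
    push_cast; ring
  rw [← Finset.prod_mul_distrib]
  rw [Finset.prod_congr rfl fun l hl => raisingCoeff_mul_self
    (by rw [Finset.mem_range] at hl; omega : j + l ≤ n)]
  rw [Finset.prod_mul_distrib, h1, h2, Nat.descFactorial_eq_factorial_mul_choose,
    Nat.ascFactorial_eq_factorial_mul_choose]
  push_cast; ring

theorem tensorNorm_zero (n t : ℕ) :
    tensorNorm n t 0 = (t.factorial : ℂ) ^ 2 * ((n + t + 1).choose (2 * t + 1) : ℕ) := by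
  rw [show 2 * t + 1 = t + t + 1 by ring, ← sum_choose_mul_choose t n t, tensorNorm, hs_eq_sum,
    Nat.cast_sum, Finset.mul_sum]
  refine Finset.sum_congr rfl fun j hj => ?_
  rw [Finset.mem_range] at hj
  simp only [tensor, entry_raising_pow]
  by_cases h : j + t ≤ n
  · rw [Finset.sum_eq_single (j + t)]
    · rw [if_pos ⟨rfl, h⟩, star_prod]
      simp only [star_raisingCoeff]
      exact prod_raisingCoeff_sq h
    · intro i _ hi
      rw [if_neg (by tauto), mul_zero]
    · simp; omega
  · rw [Finset.sum_eq_zero, Nat.choose_eq_zero_of_lt (by omega)]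
    · simp
    · intro i _
      rw [if_neg (by omega), mul_zero]

theorem phiEigenvalue_eq_of_entry {t j : ℕ} (hj : j ≤ n) {c : ℂ}
    (h : entry (superPhi n t (raising n ^ j)) j 0 = c * entry (raising n ^ j) j 0) :
    phiEigenvalue n t j = c := by
  rw [phiEigenvalue, h, mul_div_cancel_right₀ _ (entry_raising_pow_zero_ne_zero hj)]

theorem phiEigenvalue_zero_left {j : ℕ} (hj : j ≤ n) :
    phiEigenvalue n 0 j = 1 / ((n : ℂ) + 1) := by
  apply phiEigenvalue_eq_of_entry hj
  rw [superPhi_eq_tensor (Nat.zero_le n)]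
  simp [tensor, tensorNorm_zero, entry_smul]

/-- Take the trace of `Φ_t(I)`: each of the `2 t + 1` normalized tensors contributes `1`. -/
theorem phiEigenvalue_zero_right {t : ℕ} (ht : t ≤ n) :
    phiEigenvalue n t 0 = (2 * t + 1) / ((n : ℂ) + 1) := by
  have h := superPhi_tensor (n := n) t (Nat.zero_le n) 0
  have hn : (n : ℂ) + 1 ≠ 0 := Nat.cast_add_one_ne_zero n
  rw [tensor, pow_zero, superPhi_eq_tensor ht] at h
  have h2 := congrArg Matrix.trace h
  rw [Matrix.trace_sum, Matrix.trace_smul, Matrix.trace_one, Finset.sum_congr rfl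
    (g := fun _ => (1 : ℂ))] at h2
  · rw [eq_div_iff hn]
    simpa using h2.symm
  · intro m _
    rw [Matrix.trace_smul, mul_one, Matrix.trace_mul_comm, smul_eq_mul]
    exact inv_mul_cancel₀ (tensorNorm_ne_zero ht (by omega))

/-- The basis of `V_1` is `E`, `-H`, `-2F`, with squared norms in ratio `1 : 2 : 4`. In the entry
`(j, 0)` of `Φ_1(E^j)` the `E` term drops out. -/
theorem phiEigenvalue_one_left (hn : 1 ≤ n) {j : ℕ} (hj : j ≤ n) :
    phiEigenvalue n 1 j =
      3 / ((n : ℂ) + 1) - 6 * (j * (j + 1)) / (n * (n + 1) * (n + 2)) := by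
  apply phiEigenvalue_eq_of_entry hj
  have hn0 : (n : ℂ) ≠ 0 := by exact_mod_cast (by omega : n ≠ 0)
  have hn1 : (n : ℂ) + 1 ≠ 0 := Nat.cast_add_one_ne_zero n
  have hn2 : (n : ℂ) + 2 ≠ 0 := by exact_mod_cast (by omega : n + 2 ≠ 0)
  have t0 : tensor n 1 0 = raising n := pow_one _
  have t1 : tensor n 1 1 = (-1 : ℂ) • weight n := by
    rw [← lie_raising_lowering, neg_one_smul, comm_skew, tensor, t0]
  have t2 : tensor n 1 2 = (-2 : ℂ) • lowering n := by
    rw [tensor, t1, comm_smul, ← comm_skew, lie_weight_lowering]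
    module
  have N0 : tensorNorm n 1 0 = n * (n + 1) * (n + 2) / 6 := by
    have h : (n + 2).choose 3 * 6 = (n + 2) * (n + 1) * n := by
      have := Nat.descFactorial_eq_factorial_mul_choose (n + 2) 3
      simp [Nat.descFactorial, Nat.factorial] at this
      lia
    have h' : ((n + 2).choose 3 : ℂ) * 6 = (n + 2) * (n + 1) * n := by exact_mod_cast h
    rw [tensorNorm_zero]
    simp
    linear_combination h' / 6
  have N1 : tensorNorm n 1 1 = 2 * tensorNorm n 1 0 := by
    rw [tensorNorm_succ]; push_cast; ring
  have N2 : tensorNorm n 1 2 = 4 * tensorNorm n 1 0 := by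
    rw [tensorNorm_succ, N1]; push_cast; ring
  have hw : (weight n)ᴴ = weight n := by
    rw [← lie_raising_lowering, Ring.lie_def, lowering_eq]
    simp
  set X := raising n ^ j with hX
  have e1 : entry (raising n * X * lowering n) j 0 = 0 := entry_mul_lowering_zero _ _
  have e2 : entry (weight n * X * weight n) j 0 = (2 * j - n) * entry X j 0 * (-n) := by
    rw [entry_mul_weight, entry_weight_mul]; simp
  have e3 : entry (lowering n * X * raising n) j 0 = (n - j) * (j + 1) * entry X j 0 := by
    rw [mul_assoc, entry_lowering_mul, hX, ← pow_succ, pow_succ', entry_raising_mul_succ,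
      ← mul_assoc, raisingCoeff_mul_self hj]
  rw [superPhi_eq_tensor hn, Fin.sum_univ_three]
  simp only [Fin.val_zero, Fin.val_one, Fin.val_two, t0, t1, t2, N1, N2,
    Matrix.conjTranspose_smul, hw, ← lowering_eq, entry_add, entry_smul, Matrix.smul_mul,
    Matrix.mul_smul, e1, e2]
  rw [lowering_eq, Matrix.conjTranspose_conjTranspose, ← lowering_eq, e3, N0]
  simp only [star_neg, star_one, star_ofNat]
  field_simp
  ring

/-- In column `0` the product `X F` vanishes, so `ad F` acts there by left multiplication alone and
the recursion telescopes. -/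
theorem entry_tensor_zero_right {t : ℕ} (ht : t ≤ n) (m : ℕ) : ∀ k : ℕ, m + k = t →
    entry (tensor n t m) k 0 * ∏ l ∈ Finset.range k, raisingCoeff n l =
      (∏ l ∈ Finset.range t, raisingCoeff n l) * ∏ l ∈ Finset.range t, raisingCoeff n l := by
  induction m with
  | zero =>
    intro k hk
    obtain rfl : k = t := by omega
    rw [tensor, entry_raising_pow, if_pos (by omega)]
    simp
  | succ m ih =>
    intro k hk
    rw [tensor, entry_lie_lowering_zero, ← ih (k + 1) (by omega), Finset.prod_range_succ]
    ring

/-- In the last row `F X` vanishes, so only `-X F` contributes: the recursion of column `0`,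
reflected, with a sign at each step. -/
theorem entry_tensor_reflect {t : ℕ} (ht : t ≤ n) (m : ℕ) : ∀ k : ℕ, m + k = t →
    entry (tensor n t m) n (n - k) = (-1) ^ m * entry (tensor n t m) k 0 := by
  induction m with
  | zero =>
    intro k hk
    obtain rfl : k = t := by omega
    rw [tensor, entry_raising_pow, entry_raising_pow, if_pos (by omega), if_pos (by omega),
      pow_zero, one_mul, ← Finset.prod_range_reflect]
    refine Finset.prod_congr rfl fun l hl => ?_
    rw [Finset.mem_range] at hl
    exact raisingCoeff_reflect (by omega)
  | succ m ih =>
    intro k hk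
    rw [tensor, entry_lie_lowering_zero, show n - k = (n - (k + 1)) + 1 by omega,
      entry_lie_lowering_succ, raisingCoeff_self, ih (k + 1) (by omega),
      raisingCoeff_reflect (by omega : n - (k + 1) + k + 1 = n)]
    ring

theorem entry_tensor_zero_zero {t : ℕ} (ht : t ≤ n) :
    entry (tensor n t t) 0 0 = t.factorial * n.descFactorial t := by
  have h := entry_tensor_zero_right ht t 0 (add_zero t)
  have h2 := prod_raisingCoeff_sq (n := n) (t := t) (j := 0) (by omega)
  simp only [zero_add, Nat.choose_self, Nat.sub_zero, mul_one] at h2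
  rw [h2, Finset.prod_range_zero, mul_one] at h
  rw [h, Nat.descFactorial_eq_factorial_mul_choose]
  push_cast; ring

/-- `E^n` has its only nonzero entry at `(n, 0)`, so only two corners of `A` matter. -/
theorem entry_sandwich_raising_pow (A : Op n) :
    entry (A * raising n ^ n * Aᴴ) n 0 =
      entry A n n * entry (raising n ^ n) n 0 * star (entry A 0 0) := by
  rw [entry_mul, Finset.sum_eq_single 0, entry_mul, Finset.sum_eq_single n, entry_conjTranspose]
  · intro q _ hq
    rw [entry_raising_pow, if_neg (by omega), mul_zero]
  · simp
  · intro k _ hk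
    rw [entry_mul, Finset.sum_eq_zero, zero_mul]
    intro q _
    rw [entry_raising_pow, if_neg (by omega), mul_zero]
  · simp

/-- Only the weight-zero tensor `m = t` has diagonal entries; its two corners differ by `(-1)^t`,
which is the sign of the eigenvalue. -/
theorem phiEigenvalue_self_right {t : ℕ} (ht : t ≤ n) :
    phiEigenvalue n t n = (-1) ^ t *
      ((2 * t + 1) * (n.factorial : ℂ) ^ 2 / ((n + t + 1).factorial * (n - t).factorial)) := by
  apply phiEigenvalue_eq_of_entry le_rfl
  rw [superPhi_eq_tensor ht, entry_sum,
    Finset.sum_eq_single ⟨t, by omega⟩]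
  · have h := entry_tensor_reflect ht t 0 (add_zero t)
    rw [Nat.sub_zero, entry_tensor_zero_zero ht] at h
    rw [entry_smul, entry_sandwich_raising_pow, h, entry_tensor_zero_zero ht]
    have hN : tensorNorm n t t =
        (2 * t).factorial * ((t.factorial : ℂ) ^ 2 * ((n + t + 1).choose (2 * t + 1) : ℕ)) := by
      have h1 := tensorNorm_mul_factorial (n := n) t t (by omega)
      rw [show 2 * t - t = t by omega, tensorNorm_zero] at h1
      have h2 : (t.factorial : ℂ) ≠ 0 := by exact_mod_cast t.factorial_ne_zero
      apply mul_right_cancel₀ h2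
      linear_combination h1
    have hd : (n.factorial : ℂ) = (n - t).factorial * n.descFactorial t := by
      exact_mod_cast (Nat.factorial_mul_descFactorial ht).symm
    have hc : ((n + t + 1).factorial : ℂ) =
        ((n + t + 1).choose (2 * t + 1) : ℕ) * ((2 * t + 1) * (2 * t).factorial) *
          (n - t).factorial := by
      have := Nat.choose_mul_factorial_mul_factorial (show 2 * t + 1 ≤ n + t + 1 by omega)
      rw [show n + t + 1 - (2 * t + 1) = n - t by omega, Nat.factorial_succ] at this
      exact_mod_cast this.symm
    have h1 : ((t.factorial : ℕ) : ℂ) ≠ 0 := by exact_mod_cast t.factorial_ne_zero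
    have h2 : (((2 * t).factorial : ℕ) : ℂ) ≠ 0 := by exact_mod_cast (2 * t).factorial_ne_zero
    have h3 : (((n - t).factorial : ℕ) : ℂ) ≠ 0 := by exact_mod_cast (n - t).factorial_ne_zero
    have h4 : (((n + t + 1).choose (2 * t + 1) : ℕ) : ℂ) ≠ 0 := by
      exact_mod_cast (Nat.choose_pos (by omega)).ne'
    have h5 : (2 * (t : ℂ) + 1) ≠ 0 := by exact_mod_cast (by omega : 2 * t + 1 ≠ 0)
    rw [hN, hc, hd, star_mul']
    simp only [Complex.star_def, Complex.conj_natCast]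
    field_simp
  · intro m _ hm
    rw [entry_smul, entry_sandwich_raising_pow, entry_tensor_eq_zero t m (i := 0) (j := 0)]
    · simp
    · intro h
      exact hm (Fin.ext (by simpa using h))
  · simp

theorem IsWCoeff.zero_left {W : Fin (n + 1) → Fin (n + 1) → ℝ} (hW : IsWCoeff n W)
    {t : Fin (n + 1)} (ht : (t : ℕ) = 0) (j : Fin (n + 1)) : W t j = 1 / ((n : ℝ) + 1) := by
  have h := hW.eq_phiEigenvalue t j
  rw [ht, phiEigenvalue_zero_left (by omega)] at h
  exact Complex.ofReal_injective (h.trans (by push_cast; rfl))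

theorem IsWCoeff.one_left {W : Fin (n + 1) → Fin (n + 1) → ℝ} (hW : IsWCoeff n W)
    {t : Fin (n + 1)} (ht : (t : ℕ) = 1) (j : Fin (n + 1)) :
    W t j = 3 / ((n : ℝ) + 1) - 6 * ((j : ℕ) * ((j : ℕ) + 1)) / (n * (n + 1) * (n + 2)) := by
  have h := hW.eq_phiEigenvalue t j
  rw [ht, phiEigenvalue_one_left (by omega) (by omega)] at h
  exact Complex.ofReal_injective (h.trans (by push_cast; rfl))

theorem IsWCoeff.zero_right {W : Fin (n + 1) → Fin (n + 1) → ℝ} (hW : IsWCoeff n W)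
    (t : Fin (n + 1)) : W t 0 = (2 * (t : ℕ) + 1) / ((n : ℝ) + 1) := by
  have h := hW.eq_phiEigenvalue t 0
  rw [Fin.val_zero, phiEigenvalue_zero_right (by omega)] at h
  exact Complex.ofReal_injective (h.trans (by push_cast; rfl))

theorem IsWCoeff.last_right {W : Fin (n + 1) → Fin (n + 1) → ℝ} (hW : IsWCoeff n W)
    (t : Fin (n + 1)) : W t (Fin.last n) = (-1) ^ (t : ℕ) * ((2 * (t : ℕ) + 1) *
      (n.factorial : ℝ) ^ 2 / ((n + t + 1).factorial * (n - t).factorial)) := by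
  have h := hW.eq_phiEigenvalue t (Fin.last n)
  rw [Fin.val_last, phiEigenvalue_self_right (by omega)] at h
  exact Complex.ofReal_injective (h.trans (by push_cast; rfl))

/-! ### The linear programming bound -/

/-- The linear constraints for distance `2` bound the value by `n / 2`, with a unique solution for
the value `n / 2`. -/
theorem linear_programming_bound (hn : 2 ≤ n) {K : ℝ} (hK : 0 < K)
    {W : Fin (n + 1) → Fin (n + 1) → ℝ} (hW : IsWCoeff n W) {A : Fin (n + 1) → ℝ}
    (hA : ∀ t, 0 ≤ A t) (hA0 : A 0 = K)
    (h : ∀ t : Fin (n + 1), (t : ℕ) < 2 → K * ∑ j, W t j * A j = A t) :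
    K ≤ n / 2 ∧ (3 ≤ n → K = n / 2 → A = extremalDistribution n) := by
  have hn' : (2 : ℝ) ≤ n := by exact_mod_cast hn
  set u : Fin (n + 1) := ⟨1, by omega⟩ with hu
  have h0 : ∑ j, A j = n + 1 := by
    have h0 := h 0 (by simp)
    rw [hA0, Finset.sum_congr rfl fun j _ => by rw [hW.zero_left (by simp) j],
      ← Finset.mul_sum] at h0
    have h1 : 1 / ((n : ℝ) + 1) * ∑ j, A j = 1 :=
      mul_left_cancel₀ hK.ne' (h0.trans (mul_one K).symm)
    field_simp at h1
    exact h1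
  have h1 : K * (3 * (n * (n + 1) * (n + 2)) - 6 * ∑ j : Fin (n + 1), A j * ((j : ℕ) * ((j : ℕ) + 1)))
      = n * (n + 1) * (n + 2) * A u := by
    have h1 := h u (by simp [hu])
    have h2 : ∑ j, W u j * A j = 3 / ((n : ℝ) + 1) * ∑ j, A j -
        6 / (n * (n + 1) * (n + 2)) * ∑ j : Fin (n + 1), A j * ((j : ℕ) * ((j : ℕ) + 1)) := by
      rw [Finset.mul_sum, Finset.mul_sum, ← Finset.sum_sub_distrib]
      refine Finset.sum_congr rfl fun j _ => ?_
      rw [hW.one_left rfl j]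
      ring
    rw [h2, h0] at h1
    rw [← h1]
    field_simp
  set M := ∑ j : Fin (n + 1), A j * (((j : ℕ) : ℝ) * ((j : ℕ) + 1)) with hM
  have hu0 : u ≠ 0 := by simp [hu, Fin.ext_iff]
  -- The slack is dropped at `j = 0` and `j = 1`: `A_0` is known, and `A_1` must be balanced against
  -- the `t = 1` equality.
  set s : Fin (n + 1) → ℝ := fun j => if j = 0 then 0 else if j = u then 0 else
    n * (n + 1) - (j : ℕ) * ((j : ℕ) + 1) with hs
  have hs0 : ∀ j, 0 ≤ A j * s j := by
    intro j
    refine mul_nonneg (hA j) ?_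
    simp only [hs]
    split_ifs
    · exact le_rfl
    · exact le_rfl
    · have hj : ((j : ℕ) : ℝ) ≤ n := by exact_mod_cast (by omega : (j : ℕ) ≤ n)
      have : (0 : ℝ) ≤ (j : ℕ) := Nat.cast_nonneg _
      nlinarith
  have hD : ∑ j, A j * s j = n * (n + 1) * (n + 1 - K) - M - (n * (n + 1) - 2) * A u := by
    have hsj : ∀ j, A j * s j = n * (n + 1) * A j - A j * (((j : ℕ) : ℝ) * ((j : ℕ) + 1)) -
        (if j = 0 then n * (n + 1) * A j else 0) -
        (if j = u then (n * (n + 1) - 2) * A j else 0) := by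
      intro j
      simp only [hs]
      by_cases hj : j = 0
      · subst hj
        simp [hu0.symm]
      · by_cases hj1 : j = u
        · subst hj1
          simp [hu]
          ring
        · simp only [hj, hj1, if_false]
          ring
    simp only [hsj, Finset.sum_sub_distrib, Finset.sum_ite_eq', Finset.mem_univ, if_true,
      ← Finset.mul_sum, h0, hA0]
    ring
  have hD0 : 0 ≤ ∑ j, A j * s j := Finset.sum_nonneg fun j _ => hs0 j
  have hKD : K * ∑ j, A j * s j =
      K * (n * (n + 1)) * (n / 2 - K) + (n + 2) * A u * (n * (n + 1) / 6 - K * (n - 1)) := by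
    rw [hD]
    linear_combination h1 / 6
  constructor
  · by_contra! hlt
    have e1 : K * (n * (n + 1)) * (n / 2 - K) < 0 :=
      mul_neg_of_pos_of_neg (by positivity) (by linarith)
    -- As `K > n/2`, it suffices that `n (n + 1)/6 ≤ n (n - 1)/2`, which is `n ≥ 2`.
    have e2 : (n + 2) * A u * (n * (n + 1) / 6 - K * (n - 1)) ≤ 0 := by
      refine mul_nonpos_of_nonneg_of_nonpos (mul_nonneg (by positivity) (hA u)) ?_
      nlinarith
    have e3 : 0 ≤ K * ∑ j, A j * s j := mul_nonneg hK.le hD0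
    linarith
  · intro hn3 hKn
    have hn3' : (3 : ℝ) ≤ n := by exact_mod_cast hn3
    have hAu : A u = 0 := by
      refine le_antisymm ?_ (hA u)
      by_contra! hpos
      -- The same comparison is strict exactly when `n ≥ 3`; at `n = 2` the coefficient of `A_1`
      -- vanishes.
      have e2 : (n + 2) * A u * (n * (n + 1) / 6 - K * (n - 1)) < 0 := by
        refine mul_neg_of_pos_of_neg (by positivity) ?_
        rw [hKn]
        nlinarith
      have e3 : 0 ≤ K * ∑ j, A j * s j := mul_nonneg hK.le hD0
      rw [hKD, hKn, sub_self, mul_zero, zero_add, ← hKn] at e3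
      linarith
    have hDz : ∑ j, A j * s j = 0 := by
      rw [hAu, hKn, sub_self] at hKD
      simp only [mul_zero, zero_mul, add_zero] at hKD
      rw [← hKn] at hKD
      exact (mul_eq_zero.mp hKD).resolve_left hK.ne'
    have hAj : ∀ j : Fin (n + 1), (j : ℕ) ≠ 0 → (j : ℕ) ≠ n → A j = 0 := by
      intro j hj0 hjn
      by_cases hj1 : j = u
      · rw [hj1, hAu]
      · have e := (Finset.sum_eq_zero_iff_of_nonneg fun j _ => hs0 j).mp hDz j (Finset.mem_univ j)
        refine (mul_eq_zero.mp e).resolve_right ?_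
        simp only [hs]
        rw [if_neg (fun h' => hj0 (by simp [h'])), if_neg hj1]
        have hj : ((j : ℕ) : ℝ) + 1 ≤ n := by exact_mod_cast (by omega : (j : ℕ) + 1 ≤ n)
        have : (0 : ℝ) ≤ (j : ℕ) := Nat.cast_nonneg _
        nlinarith
    have hlast : A (Fin.last n) = n / 2 + 1 := by
      have hne : (0 : Fin (n + 1)) ≠ Fin.last n := by simp [Fin.ext_iff]; omega
      have e := Finset.sum_eq_add (s := Finset.univ) (f := A) 0 (Fin.last n) hne
        (fun j _ hj => hAj j (fun h' => hj.1 (Fin.ext (by simpa using h')))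
          (fun h' => hj.2 (Fin.ext (by simpa using h')))) (by simp) (by simp)
      rw [h0, hA0] at e
      linarith
    funext t
    rw [extremalDistribution]
    split_ifs with ht0 htn
    · rw [show t = 0 from Fin.ext (by simpa using ht0), hA0, hKn]
    · rw [show t = Fin.last n from Fin.ext (by simpa using htn), hlast]
    · exact hAj t ht0 htn

/-! ### Feasibility of the extremal distribution -/

/-- Passing from `t` to `t + 1` multiplies the product by `(b + t + 2)/(b - t) ≥ 1`. -/
theorem factorial_mul_factorial_le {a b : ℕ} : ∀ {t : ℕ}, a ≤ t → t ≤ b →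
    (b + a + 1).factorial * (b - a).factorial ≤ (b + t + 1).factorial * (b - t).factorial := by
  intro t hat
  induction t, hat using Nat.le_induction with
  | base => intro _; exact le_rfl
  | succ t _ ih =>
    intro htb
    refine (ih (by omega)).trans ?_
    rw [show b - t = (b - (t + 1)) + 1 by omega, show b + (t + 1) + 1 = (b + t + 1) + 1 by ring,
      Nat.factorial_succ (b - (t + 1)), Nat.factorial_succ (b + t + 1), mul_left_comm, mul_assoc]
    exact Nat.mul_le_mul_right _ (by omega)

theorem factorial_sq_div_le (hn : 1 ≤ n) {t : ℕ} (h1 : 1 ≤ t) (ht : t ≤ n) :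
    (n.factorial : ℝ) ^ 2 / ((n + t + 1).factorial * (n - t).factorial) ≤
      n / ((n + 1) * (n + 2)) := by
  rw [div_le_div_iff₀ (by positivity) (by positivity)]
  have h := factorial_mul_factorial_le h1 ht
  have e : n.factorial ^ 2 * ((n + 1) * (n + 2)) =
      n * ((n + 1 + 1).factorial * (n - 1).factorial) := by
    obtain ⟨m, rfl⟩ : ∃ m, n = m + 1 := ⟨n - 1, by omega⟩
    simp only [Nat.add_sub_cancel, Nat.factorial_succ]
    ring
  exact_mod_cast e.trans_le (Nat.mul_le_mul_left n h)

theorem factorial_sq_div_le_of_two_le (hn : 2 ≤ n) {t : ℕ} (h2 : 2 ≤ t) (ht : t ≤ n) :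
    (n.factorial : ℝ) ^ 2 / ((n + t + 1).factorial * (n - t).factorial) ≤
      n * (n - 1) / ((n + 1) * (n + 2) * (n + 3)) := by
  rw [div_le_div_iff₀ (by positivity) (by positivity)]
  have h := factorial_mul_factorial_le h2 ht
  have e : n.factorial ^ 2 * ((n + 1) * (n + 2) * (n + 3)) =
      n * (n - 1) * ((n + 2 + 1).factorial * (n - 2).factorial) := by
    obtain ⟨m, rfl⟩ : ∃ m, n = m + 2 := ⟨n - 2, by omega⟩
    simp only [Nat.add_sub_cancel, show m + 2 - 1 = m + 1 by omega, Nat.factorial_succ]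
    ring
  have h' := e.trans_le (Nat.mul_le_mul_left (n * (n - 1)) h)
  have h1 : ((n - 1 : ℕ) : ℝ) = n - 1 := by rw [Nat.cast_sub (by omega), Nat.cast_one]
  rw [← h1]
  exact_mod_cast h'

theorem sum_mul_extremalDistribution (hn : 2 ≤ n) (f : Fin (n + 1) → ℝ) :
    ∑ j, f j * extremalDistribution n j = f 0 * (n / 2) + f (Fin.last n) * (n / 2 + 1) := by
  have hne : (0 : Fin (n + 1)) ≠ Fin.last n := by simp [Fin.ext_iff]; omega
  rw [Finset.sum_eq_add (s := Finset.univ) 0 (Fin.last n) hne]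
  · have h0 : n ≠ 0 := by omega
    simp [extremalDistribution, h0]
  · intro j _ hj
    rw [extremalDistribution, if_neg (fun h' => hj.1 (Fin.ext (by simpa using h'))),
      if_neg (fun h' => hj.2 (Fin.ext (by simpa using h'))), mul_zero]
  · simp
  · simp

theorem neg_one_pow_mul_ge {x : ℝ} (hx : 0 ≤ x) (t : ℕ) : -x ≤ (-1) ^ t * x := by
  rcases neg_one_pow_eq_or ℝ t with h | h <;> rw [h] <;> linarith

theorem isFeasible_extremalDistribution (hn : 2 ≤ n) :
    IsFeasible n 2 (n / 2) (extremalDistribution n) := by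
  have hn' : (2 : ℝ) ≤ n := by exact_mod_cast hn
  obtain ⟨W, hW⟩ : ∃ W, IsWCoeff n W := ⟨_, isWCoeff_phiEigenvalue n⟩
  have heq : ∀ t : Fin (n + 1), (t : ℕ) < 2 →
      n / 2 * ∑ j, W t j * extremalDistribution n j = extremalDistribution n t := by
    intro t ht
    rw [sum_mul_extremalDistribution hn]
    rcases (by omega : (t : ℕ) = 0 ∨ (t : ℕ) = 1) with h | h
    · rw [hW.zero_left h, hW.zero_left h, extremalDistribution, if_pos h]
      field_simp
      ring
    · rw [hW.one_left h, hW.one_left h, extremalDistribution, if_neg (by omega),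
        if_neg (by omega), Fin.val_zero, Fin.val_last]
      field_simp
      push_cast
      ring
  refine ⟨W, hW, fun t => ?_, by simp [extremalDistribution], heq, fun t => ?_⟩
  · rw [extremalDistribution]
    split_ifs <;> positivity
  · by_cases ht : (t : ℕ) < 2
    · exact (heq t ht).ge
    rw [sum_mul_extremalDistribution hn, hW.zero_right, hW.last_right, extremalDistribution,
      if_neg (by omega)]
    set g : ℝ := (n.factorial : ℝ) ^ 2 / ((n + t + 1).factorial * (n - t).factorial) with hg
    have hg0 : 0 ≤ g := by positivity
    have hx : (2 * ((t : ℕ) : ℝ) + 1) * (n.factorial : ℝ) ^ 2 /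
        ((n + t + 1).factorial * (n - t).factorial) = (2 * (t : ℕ) + 1) * g := by
      rw [hg, mul_div_assoc]
    rw [hx]
    have hsign := neg_one_pow_mul_ge (mul_nonneg (by positivity : 0 ≤ 2 * ((t : ℕ) : ℝ) + 1) hg0) t
    have hle : (2 * ((t : ℕ) : ℝ) + 1) / (n + 1) * (n / 2) - (2 * (t : ℕ) + 1) * g * (n / 2 + 1) ≤
        (2 * ((t : ℕ) : ℝ) + 1) / (n + 1) * (n / 2) +
          (-1) ^ (t : ℕ) * ((2 * (t : ℕ) + 1) * g) * (n / 2 + 1) := by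
      nlinarith
    split_ifs with htn
    · have hg2 := factorial_sq_div_le_of_two_le hn (t := t) (by omega) (by omega)
      rw [← hg] at hg2
      -- For `t = n = 2` discarding the sign loses too much, but there the sign is positive and the
      -- inequality is numerical.
      rcases hn.eq_or_lt with h2 | h3
      · subst h2
        simp only [hg, htn, Nat.factorial]
        norm_num
      · have h3' : (3 : ℝ) ≤ n := by exact_mod_cast h3
        rw [htn] at hle ⊢
        -- The bound from `t = 2` makes the subtracted term at most `(n - 1)/(n + 3)` of the first
        -- one, leaving the fraction `4/(n + 3)`.
        have hb : (2 * (n : ℝ) + 1) / (n + 1) * (n / 2) * (4 / (n + 3)) ≤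
            (2 * (n : ℝ) + 1) / (n + 1) * (n / 2) - (2 * n + 1) * g * (n / 2 + 1) := by
          have e : (2 * (n : ℝ) + 1) / (n + 1) * (n / 2) * (4 / (n + 3)) =
            (2 * (n : ℝ) + 1) / (n + 1) * (n / 2) -
              (2 * n + 1) * (n * (n - 1) / ((n + 1) * (n + 2) * (n + 3))) * (n / 2 + 1) := by
            field_simp
            ring
          rw [e]
          gcongr
        refine le_trans ?_ (mul_le_mul_of_nonneg_left (hb.trans hle) (by positivity))
        have e : (n : ℝ) / 2 * ((2 * (n : ℝ) + 1) / (n + 1) * (n / 2) * (4 / (n + 3))) =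
            n ^ 2 * (2 * n + 1) / ((n + 1) * (n + 3)) := by
          field_simp
          ring
        rw [e, le_div_iff₀ (by positivity)]
        nlinarith [mul_nonneg (sub_nonneg.mpr h3') (sq_nonneg (n : ℝ))]
    · have hg1 := factorial_sq_div_le (by omega : 1 ≤ n) (t := t) (by omega) (by omega)
      rw [← hg] at hg1
      refine mul_nonneg (by positivity) (le_trans ?_ hle)
      -- The bound from `t = 1` makes the contributions of `A_0` and `A_n` cancel exactly.
      have e : (2 * ((t : ℕ) : ℝ) + 1) / (n + 1) * (n / 2) =
          (2 * (t : ℕ) + 1) * (n / ((n + 1) * (n + 2))) * (n / 2 + 1) := by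
        field_simp
      rw [e, sub_nonneg]
      gcongr

/-! ### Distance distributions of codes -/

theorem toEuclideanLin_codeProj (C : Submodule ℂ (Space n)) :
    Matrix.toEuclideanLin (codeProj C) = (C.starProjection : Space n →ₗ[ℂ] Space n) :=
  LinearEquiv.apply_symm_apply _ _

theorem codeProj_mul_self (C : Submodule ℂ (Space n)) : codeProj C * codeProj C = codeProj C := by
  apply Matrix.toEuclideanLin.injective
  rw [Matrix.toLpLin_mul_same, toEuclideanLin_codeProj]
  ext1 x
  exact congrArg (fun T => T x) C.isIdempotentElem_starProjection

theorem conjTranspose_codeProj (C : Submodule ℂ (Space n)) : (codeProj C)ᴴ = codeProj C := by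
  apply Matrix.toEuclideanLin.injective
  rw [Matrix.toEuclideanLin_conjTranspose_eq_adjoint, toEuclideanLin_codeProj]
  exact ((LinearMap.isSymmetric_iff_isSelfAdjoint _).mp C.starProjection_isSymmetric)

theorem trace_codeProj (C : Submodule ℂ (Space n)) :
    (codeProj C).trace = Module.finrank ℂ C := by
  have h : LinearMap.IsProj C (C.starProjection : Space n →ₗ[ℂ] Space n) :=
    ⟨fun x => C.starProjection_apply_mem x, fun x hx => C.starProjection_eq_self_iff.mpr hx⟩
  rw [← h.trace, ← toEuclideanLin_codeProj, Matrix.toEuclideanLin_eq_toLin_orthonormal,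
    Matrix.trace_toLin_eq]

theorem distanceDistribution_nonneg (C : Submodule ℂ (Space n)) (t : Fin (n + 1)) :
    0 ≤ distanceDistribution C t := by
  unfold distanceDistribution; positivity

theorem distanceDistribution_eq_hs (C : Submodule ℂ (Space n)) (t : Fin (n + 1)) :
    (distanceDistribution C t : ℂ) = ((n : ℂ) + 1) / Module.finrank ℂ C *
      hs (codeProj C) (superPi n t (codeProj C)) := by
  rw [distanceDistribution, superPi_eq_sum, hs_sum_right]
  push_cast
  congr 1
  refine Finset.sum_congr rfl fun i _ => ?_
  rw [hs_smul_right, ← star_hs (errorBasis n t i), ← Complex.conj_mul', mul_comm]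
  rfl

theorem distanceDistribution_zero {C : Submodule ℂ (Space n)} (hC : Module.finrank ℂ C ≠ 0) :
    distanceDistribution C 0 = Module.finrank ℂ C := by
  apply Complex.ofReal_injective
  have hK : (Module.finrank ℂ C : ℂ) ≠ 0 := by exact_mod_cast hC
  have hn : (n : ℂ) + 1 ≠ 0 := Nat.cast_add_one_ne_zero n
  have h1 : ∀ X : Op n, superPi n 0 X = (((n : ℂ) + 1)⁻¹ * X.trace) • (1 : Op n) := by
    intro X
    rw [superPi_eq_tensor (Nat.zero_le n)]
    simp [tensor, tensorNorm_zero, hs, mul_smul]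
  rw [distanceDistribution_eq_hs, Fin.val_zero, h1, hs_smul_right, hs, mul_one,
    conjTranspose_codeProj, trace_codeProj]
  push_cast
  field_simp

theorem sum_mul_distanceDistribution {W : Fin (n + 1) → Fin (n + 1) → ℝ} (hW : IsWCoeff n W)
    (C : Submodule ℂ (Space n)) (t : Fin (n + 1)) :
    ((∑ j, W t j * distanceDistribution C j : ℝ) : ℂ) =
      ((n : ℂ) + 1) / Module.finrank ℂ C * hs (codeProj C) (superPhi n t (codeProj C)) := by
  rw [hW, hs_sum_right, Finset.mul_sum]
  push_cast
  refine Finset.sum_congr rfl fun j _ => ?_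
  rw [distanceDistribution_eq_hs, hs_smul_right]
  ring

/-- If `P B P = ε P`, then `tr (P B P Bᴴ) = |ε|² K` while `|tr (Bᴴ P)|² = |ε|² K²`, where `K = tr
P`. So the equality already holds for each basis error. -/
theorem HasDistance.constraint {C : Submodule ℂ (Space n)} {d : ℕ} (hd : HasDistance C d)
    (hC : Module.finrank ℂ C ≠ 0) {W : Fin (n + 1) → Fin (n + 1) → ℝ} (hW : IsWCoeff n W)
    (t : Fin (n + 1)) (ht : (t : ℕ) < d) :
    Module.finrank ℂ C * ∑ j, W t j * distanceDistribution C j = distanceDistribution C t := by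
  apply Complex.ofReal_injective
  have hK : (Module.finrank ℂ C : ℂ) ≠ 0 := by exact_mod_cast hC
  rw [Complex.ofReal_mul, sum_mul_distanceDistribution hW, distanceDistribution_eq_hs,
    Complex.ofReal_natCast, mul_left_comm]
  congr 1
  rw [superPhi, superPi_eq_sum, hs_sum_right, hs_sum_right, Finset.mul_sum]
  refine Finset.sum_congr rfl fun i _ => ?_
  set B := errorBasis n t i with hB
  set P := codeProj C with hP
  obtain ⟨ε, hε⟩ := hd t ht B (errorBasis_mem _ i).1
  have hPP : P * P = P := codeProj_mul_self C
  have hPs : Pᴴ = P := conjTranspose_codeProj C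
  have htr : (P * B).trace = ε * Module.finrank ℂ C := by
    have h := congrArg Matrix.trace hε
    rwa [Matrix.trace_mul_comm, ← mul_assoc, hPP, Matrix.trace_smul, trace_codeProj] at h
  have htr' : hs P B = ε * Module.finrank ℂ C := by rw [hs, hPs, htr]
  have htr2 : hs B P = star ε * Module.finrank ℂ C := by
    rw [← star_hs, htr', star_mul', star_natCast]
  have h1 : hs P (B * P * Bᴴ) = ε * hs B P := by
    rw [hs, hPs, ← mul_assoc, ← mul_assoc, hε, Matrix.smul_mul, Matrix.trace_smul, hs,
      Matrix.trace_mul_comm, smul_eq_mul]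
  rw [h1, hs_smul_right, htr', htr2]
  ring

theorem HasDistance.finrank_le {C : Submodule ℂ (Space n)} (hn : 2 ≤ n) (hd : HasDistance C 2) :
    (Module.finrank ℂ C : ℝ) ≤ n / 2 := by
  by_cases hC : Module.finrank ℂ C = 0
  · rw [hC, Nat.cast_zero]; positivity
  · have hW := isWCoeff_phiEigenvalue n
    exact (linear_programming_bound hn (by exact_mod_cast Nat.pos_of_ne_zero hC) hW
      (distanceDistribution_nonneg C) (distanceDistribution_zero hC) (hd.constraint hC hW)).1

theorem HasDistance.distanceDistribution_eq {C : Submodule ℂ (Space n)} (hn : 3 ≤ n)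
    (hd : HasDistance C 2) (hC : (Module.finrank ℂ C : ℝ) = n / 2) :
    distanceDistribution C = extremalDistribution n := by
  have hn0 : (3 : ℝ) ≤ n := by exact_mod_cast hn
  have hC0 : Module.finrank ℂ C ≠ 0 := by
    intro h
    rw [h, Nat.cast_zero] at hC
    linarith
  have hW := isWCoeff_phiEigenvalue n
  exact (linear_programming_bound (by omega) (by rw [hC]; positivity) hW
    (distanceDistribution_nonneg C) (distanceDistribution_zero hC0)
    (hd.constraint hC0 hW)).2 hn hC

theorem IsFeasible.eq_extremalDistribution (hn : 3 ≤ n) {A : Fin (n + 1) → ℝ}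
    (hA : IsFeasible n 2 (n / 2) A) : A = extremalDistribution n := by
  obtain ⟨W, hW, h0, hA0, h1, -⟩ := hA
  exact (linear_programming_bound (by omega) (by positivity) hW h0 hA0 h1).2 hn rfl

end SpinCode

theorem mainTheorem9 (n : ℕ) (hn : 2 ≤ n) :
    (∀ C : Submodule ℂ (SpinCode.Space n), SpinCode.HasDistance C 2 →
      (Module.finrank ℂ C : ℝ) ≤ (n : ℝ) / 2) ∧
    SpinCode.IsFeasible n 2 ((n : ℝ) / 2) (SpinCode.extremalDistribution n) ∧
    (3 ≤ n → ∀ A : Fin (n + 1) → ℝ, SpinCode.IsFeasible n 2 ((n : ℝ) / 2) A →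
      A = SpinCode.extremalDistribution n) ∧
    (3 ≤ n → ∀ C : Submodule ℂ (SpinCode.Space n), SpinCode.HasDistance C 2 →
      (Module.finrank ℂ C : ℝ) = (n : ℝ) / 2 →
      SpinCode.distanceDistribution C = SpinCode.extremalDistribution n) :=
  ⟨fun _ hC => hC.finrank_le hn, SpinCode.isFeasible_extremalDistribution hn,
    fun hn3 _ hA => hA.eq_extremalDistribution hn3,
    fun hn3 _ hC hK => hC.distanceDistribution_eq hn3 hK⟩
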